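/- **Setting.** Points of the square are pairs of infinite binary expansions; a *basic dyadic rectangle* $I\times J$ is a product of two basic dyadic intervals (all expansions with a given finite prefix). The group $2V$ consists of the bijections $f$ of the square for which the square is filled by finitely many basic dyadic rectangles, each mapped by $f$ affinely (by exchanging prefixes) onto a basic dyadic rectangle. A *vertical* (resp. *horizontal*) caret of a binary tree halves a rectangle by a vertical (resp. horizontal) segment; leaves are numbered $0,1,2,\dots$ from left to right; the *spine* of a tree is its right side. Maps act on the right, so products are read from left to right. A *grid tree-pair diagram* consists of a tree $T_v$ of vertical carets and a tree $T_h$ of horizontal carets, and of a target subdivision of the square obtained by repeated halving, whose rectangles are matched with those of the source grid, i.e. with the leaves of the tree $T$ obtained by hanging a copy of $T_h$ from each leaf of $T_v$. It represents $f$ if $f$ maps every source rectangle affinely onto the matching target rectangle. It is *reduced* if for every exposed caret of $T_v$, with leaves the two halves of $I$, there is a leaf $J$ of $T_h$ such that $f$ does not map $I\times J$ affinely onto a basic dyadic rectangle, and likewise with the roles of $T_v$ and $T_h$ exchanged. For a tree $S$ with $k$ carets let $[S]\in 2V$ be the element that maps the leaves of $S$, in order, to the leaves of the all-right tree $R_k$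 with $k$ vertical carets. Let $A_i$ (resp. $B_i$) be $[S]$ for $S=R_{i+1}$ with a vertical (resp. horizontal) caret attached at leaf $i$; let $C_i$ be $[S]$ for the all-right tree $S$ with carets $0,\dots,i$ of which only caret $i$ is horizontal; let $\Pi_i$, $\overline{\Pi}_i$ interchange the leaves $i,i+1$ of $R_{i+2}$, resp. $R_{i+1}$. **Theorem.** Every $f\in 2V$ has a unique reduced grid tree-pair diagram, and this diagram gives rise to a unique positive prefix word in the letters $A_i,B_j,C_k$, as follows. Let $T_v$ have $n+1$ leaves and $T_h$ have $m+1$ leaves, let $i$ and $s$ be the numbers of carets on the spines of $T_v$ and $T_h$, let $a_j$ and $b_p$ be the lengths of the maximal paths of left edges going up from leaf $j$ of $T_v$, resp. leaf $p$ of $T_h$, and not reaching the spine, and let $b'_p$ be the length of the maximal path of left edges going up from leaf $p$ of $T_h$. Then: 1. $[T_v]=A_0^{a_0}A_1^{a_1}\cdots A_n^{a_n}$, and the exponents $a_0,\dots,a_n$ are unique with this property. 2. (On the spine) $[T_h]=C_0C_1\cdots C_{s-1}\,B_0^{b_0}B_1^{b_1}\cdots B_m^{b_m}$, and the exponents $b_p$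 are unique with this property. 3. (Off the spine) for the tree $T_h'$ obtained by hanging $T_h$ from the left leaf of a vertical caret, $[T_h']=B_0^{b'_0}B_1^{b'_1}\cdots B_m^{b'_m}$, and the exponents $b'_p$ are unique with this property. 4. For every $p$, $b'_p=b_p$ or $b'_p=b_p+1$. 5. For the full tree $T$ of the source grid, $$[T]=P:=C_iC_{i+1}\cdots C_{i+s-1}\;\Bigl(\prod_{j=0}^{n-1}A_{(m+1)j}^{a_j}B_{(m+1)j}^{b'_0}B_{(m+1)j+1}^{b'_1}\cdots B_{(m+1)j+m}^{b'_m}\Bigr)\;A_{(m+1)n}^{a_n}B_{(m+1)n}^{b_0}B_{(m+1)n+1}^{b_1}\cdots B_{(m+1)n+m}^{b_m}$$ (with no letters $C$ if $m=0$), and $P$ is the only word of this type, with arbitrary values of $i$, $s$ and of the exponents, that represents $[T]$. 6. For every tree $S$ whose leaves are the rectangles of the target subdivision, $f=P\,\Pi\,N^{-1}$, where $\Pi$ is a word in the letters $\Pi_i,\overline{\Pi}_i$ that permutes the leaves of the all-right tree with as many leaves as $S$, and $N$ is a positive word representing $[S]$, consisting of letters $C_k$ with increasing indices followed by letters $A_k,B_k$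 with nondecreasing indices. -/

import Mathlib

namespace Thompson2V

/-! ### The Cantor square and the group `2V` -/

/-- The square, as the product of two Cantor sets of infinite binary expansions. The first
coordinate is the horizontal position (`false` is the left half, `true` the right half), the second
one the vertical position (`false` is the half that belongs to the left leaf of a horizontal
caret, `true` the other half). -/
abbrev Square : Type := Stream' Bool × Stream' Bool

/-- A basic dyadic rectangle `I × J`: a finite word names the basic dyadic interval of all
expansions that start with this word. -/
abbrev Rect : Type := List Bool × List Bool

/-- The point of the rectangle `r` with relative position `z`. Thus `r.place` is the affine
identification of the square with `r`, and its range is the set of points of `r`. -/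
def Rect.place (r : Rect) (z : Square) : Square :=
  (Stream'.appendStream' r.1 z.1, Stream'.appendStream' r.2 z.2)

/-- `f` maps the basic dyadic rectangle `r` affinely onto the basic dyadic rectangle `r'`. -/
def MapsRect (f : Equiv.Perm Square) (r r' : Rect) : Prop :=
  ∀ z : Square, f (Rect.place r z) = Rect.place r' z

/-- `f` is affine on each of finitely many basic dyadic rectangles that fill the square, with basic
dyadic rectangles as images. -/
def IsDyadic (f : Equiv.Perm Square) : Prop :=
  ∃ s : Finset Rect, (∀ z : Square, ∃ r ∈ s, z ∈ Set.range (Rect.place r)) ∧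
    ∀ r ∈ s, ∃ r' : Rect, MapsRect f r r'

theorem place_append (r : Rect) (u v : List Bool) (z : Square) :
    Rect.place (r.1 ++ u, r.2 ++ v) z = Rect.place r (Rect.place (u, v) z) := by
  simp [Rect.place]

theorem exists_append_of_stream {p q : List Bool} {x y : Stream' Bool}
    (h : Stream'.appendStream' p x = Stream'.appendStream' q y) (hl : p.length ≤ q.length) :
    ∃ w, q = p ++ w := by
  induction p generalizing q with
  | nil => exact ⟨q, rfl⟩
  | cons a p ih =>
    cases q with
    | nil => simp at hl
    | cons b q =>
      simp only [Stream'.cons_append_stream] at h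
      have h' := Stream'.cons_injective2 h
      obtain ⟨w, hw⟩ := ih h'.2 (by simpa using hl)
      exact ⟨w, by simp [h'.1, hw]⟩

theorem isDyadic_one : IsDyadic 1 :=
  ⟨{([], [])}, fun z => ⟨_, Finset.mem_singleton_self _, z, rfl⟩, fun r _ => ⟨r, fun _ => rfl⟩⟩

theorem IsDyadic.inv {f : Equiv.Perm Square} (hf : IsDyadic f) : IsDyadic f⁻¹ := by
  classical
  obtain ⟨s, hs, hm⟩ := hf
  choose! g hg using hm
  refine ⟨s.image g, fun z => ?_, fun r hr => ?_⟩
  · obtain ⟨r, hr, y, hy⟩ := hs (f⁻¹ z)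
    refine ⟨g r, Finset.mem_image_of_mem g hr, y, ?_⟩
    rw [← hg r hr y, hy]; exact f.apply_symm_apply z
  · obtain ⟨r, hr0, rfl⟩ := Finset.mem_image.1 hr
    exact ⟨r, fun z => by rw [← hg r hr0 z]; exact f.symm_apply_apply _⟩

theorem IsDyadic.mul {f g : Equiv.Perm Square} (hf : IsDyadic f) (hg : IsDyadic g) :
    IsDyadic (f * g) := by
  classical
  obtain ⟨t, ht, hft⟩ := hf
  obtain ⟨s, hs, hgs⟩ := hg
  let N : ℕ := t.sup fun r => max r.1.length r.2.length
  let W : Finset (List Bool) := Finset.univ.image (List.ofFn : (Fin N → Bool) → List Bool)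
  have hW : ∀ u, u ∈ W ↔ u.length = N := by
    intro u
    constructor
    · intro hu
      obtain ⟨k, -, rfl⟩ := Finset.mem_image.1 hu
      simp
    · intro hu
      refine Finset.mem_image.2 ⟨fun i => u.get (Fin.cast hu.symm i), Finset.mem_univ _, ?_⟩
      apply List.ext_get <;> simp [hu]
  refine ⟨(s ×ˢ W ×ˢ W).image fun x => (x.1.1 ++ x.2.1, x.1.2 ++ x.2.2), fun z => ?_,
    fun r hr => ?_⟩
  · obtain ⟨r, hr, y, rfl⟩ := hs z
    refine ⟨(r.1 ++ y.1.take N, r.2 ++ y.2.take N), Finset.mem_image.2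
      ⟨(r, y.1.take N, y.2.take N), ?_, rfl⟩, (y.1.drop N, y.2.drop N), ?_⟩
    · simp [hr, hW, Stream'.length_take]
    · rw [place_append]
      simp [Rect.place, Stream'.append_take_drop]
  · obtain ⟨⟨r, u, v⟩, hx, rfl⟩ := Finset.mem_image.1 hr
    simp only [Finset.mem_product, hW] at hx
    obtain ⟨hr, hu, hv⟩ := hx
    obtain ⟨r', hr'⟩ := hgs r hr
    let z₀ : Square := (Stream'.const false, Stream'.const false)
    obtain ⟨q, hq, y, hy⟩ := ht (Rect.place (r'.1 ++ u, r'.2 ++ v) z₀)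
    obtain ⟨q', hq'⟩ := hft q hq
    have hN : max q.1.length q.2.length ≤ N :=
      Finset.le_sup (f := fun r : Rect => max r.1.length r.2.length) hq
    have h1 := congrArg Prod.fst hy
    have h2 := congrArg Prod.snd hy
    simp only [Rect.place] at h1 h2
    obtain ⟨w1, hw1⟩ := exists_append_of_stream h1 (by simp; omega)
    obtain ⟨w2, hw2⟩ := exists_append_of_stream h2 (by simp; omega)
    refine ⟨(q'.1 ++ w1, q'.2 ++ w2), fun z => ?_⟩
    rw [Equiv.Perm.mul_apply]
    simp only
    rw [place_append, hr', ← place_append, hw1, hw2, place_append, hq', place_append]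

end Thompson2V

/-- The higher-dimensional Thompson group `2V`. -/
def TwoV : Subgroup (Equiv.Perm Thompson2V.Square) where
  carrier := {f | Thompson2V.IsDyadic f}
  mul_mem' := Thompson2V.IsDyadic.mul
  one_mem' := Thompson2V.isDyadic_one
  inv_mem' := Thompson2V.IsDyadic.inv

namespace Thompson2V

/-! ### Trees with two types of carets -/

/-- The two types of carets: a (triangular) `vert` caret halves a rectangle by a vertical segment,
a (square) `horiz` caret halves it by a horizontal segment. -/
inductive Caret : Type
  | vert
  | horiz

/-- The half of a rectangle position cut out by a caret: prepend one digit in one coordinate. -/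
def Caret.child : Caret → Bool → Rect → Rect
  | .vert, e, r => (e :: r.1, r.2)
  | .horiz, e, r => (r.1, e :: r.2)

/-- The basic dyadic rectangles at the leaves of a tree, from left to right. -/
def leafRects : BinaryTree Caret → List Rect
  | .nil => [([], [])]
  | .node c l r => (leafRects l).map (c.child false) ++ (leafRects r).map (c.child true)

/-- The basic dyadic intervals at the leaves of a tree of a single type, from left to right. -/
def leafIntervals : BinaryTree Unit → List (List Bool)
  | .nil => [[]]
  | .node _ l r => (leafIntervals l).map (List.cons false) ++ (leafIntervals r).map (List.cons true)

/-- The tree obtained from `T` by hanging a copy of `H` from every leaf. -/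
def hang : BinaryTree Caret → BinaryTree Caret → BinaryTree Caret
  | .nil, H => H
  | .node c l r, H => .node c (hang l H) (hang r H)

/-- The tree all of whose carets have type `c`. -/
def paint (c : Caret) (T : BinaryTree Unit) : BinaryTree Caret := T.map fun _ => c

/-- The tree of the grid square given by `Tv` and `Th`: a copy of `Th`, with horizontal carets,
hangs from each leaf of `Tv`, which has vertical carets. -/
def gridTree (Tv Th : BinaryTree Unit) : BinaryTree Caret :=
  hang (paint .vert Tv) (paint .horiz Th)

/-! ### Grid diagrams -/

/-- A grid tree-pair diagram: a source grid square given by its two trees, and a target square with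
a subdivision obtained by repeated halving, whose rectangles are listed in the order of the
rectangles of the source (the leaves of `gridTree Tv Th` from left to right). -/
structure GridDiagram : Type where
  Tv : BinaryTree Unit
  Th : BinaryTree Unit
  target : List Rect
  length_target : target.length = (leafRects (gridTree Tv Th)).length
  isSubdivision : ∃ S : BinaryTree Caret, target.Perm (leafRects S)

/-- The diagram `D` represents `f`: each rectangle of the source grid is mapped affinely onto the
corresponding rectangle of the target. -/
def GridDiagram.Represents (D : GridDiagram) (f : Equiv.Perm Square) : Prop :=
  List.Forall₂ (MapsRect f) (leafRects (gridTree D.Tv D.Th)) D.target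

/-- No exposed caret of `Tv` can be erased: if the leaves of an exposed caret are the two halves of
`I`, then for some leaf `J` of `Th` the map is not affine on `I × J` with a basic dyadic rectangle
as its image. -/
def GridDiagram.VerticallyReduced (D : GridDiagram) (f : Equiv.Perm Square) : Prop :=
  ∀ I : List Bool, I ++ [false] ∈ leafIntervals D.Tv → I ++ [true] ∈ leafIntervals D.Tv →
    ∃ J ∈ leafIntervals D.Th, ¬ ∃ r' : Rect, MapsRect f (I, J) r'

/-- No exposed caret of `Th` can be erased. -/
def GridDiagram.HorizontallyReduced (D : GridDiagram) (f : Equiv.Perm Square) : Prop :=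
  ∀ J : List Bool, J ++ [false] ∈ leafIntervals D.Th → J ++ [true] ∈ leafIntervals D.Th →
    ∃ I ∈ leafIntervals D.Tv, ¬ ∃ r' : Rect, MapsRect f (I, J) r'

/-- `D` is a reduced grid tree-pair diagram of `f`. -/
def GridDiagram.IsReducedFor (D : GridDiagram) (f : Equiv.Perm Square) : Prop :=
  D.Represents f ∧ D.VerticallyReduced f ∧ D.HorizontallyReduced f

/-! ### Elements given by trees -/

/-- Halving the square. -/
def halve : Caret → Square ≃ Bool × Square
  | .vert =>
    { toFun := fun z => (z.1.head, (z.1.tail, z.2))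
      invFun := fun p => (Stream'.cons p.1 p.2.1, p.2.2)
      left_inv := fun z => Prod.ext (Stream'.eta z.1) rfl
      right_inv := fun _ => rfl }
  | .horiz =>
    { toFun := fun z => (z.2.head, (z.1, z.2.tail))
      invFun := fun p => (p.2.1, Stream'.cons p.1 p.2.2)
      left_inv := fun z => Prod.ext rfl (Stream'.eta z.2)
      right_inv := fun _ => rfl }

/-- A point of the square is sent to the number of the leaf rectangle of `T` that contains it
(leaves are numbered `0, 1, 2, …` from left to right) and its relative position there. -/
def locate : (T : BinaryTree Caret) → Square ≃ Fin T.numLeaves × Square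
  | .nil => (Equiv.uniqueProd Square (Fin 1)).symm
  | .node c l r =>
    (halve c).trans <| (Equiv.boolProdEquivSum Square).trans <|
      (Equiv.sumCongr (locate l) (locate r)).trans <|
        (Equiv.sumProdDistrib (Fin l.numLeaves) (Fin r.numLeaves) Square).symm.trans <|
          Equiv.prodCongr finSumFinEquiv (Equiv.refl Square)

/-- The element of the tree-pair diagram with source tree `T`, target tree `S` and bijection `σ` of
the leaves. -/
def ofDiagram (T S : BinaryTree Caret) (σ : Fin T.numLeaves ≃ Fin S.numLeaves) :
    Equiv.Perm Square :=
  (locate T).trans <| (Equiv.prodCongr σ (Equiv.refl Square)).trans (locate S).symm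

/-- The all-right tree with `k` carets, all of them vertical. -/
def allRight : ℕ → BinaryTree Caret
  | 0 => .nil
  | k + 1 => .node .vert .nil (allRight k)

theorem numLeaves_allRight (k : ℕ) : (allRight k).numLeaves = k + 1 := by
  induction k with
  | zero => rfl
  | succ k ih => simp [allRight, ih, Nat.add_comm]

/-- The positive element of the tree `T`: it maps the leaves of `T`, in order, to the leaves of the
all-right tree with as many carets. -/
def ofTree (T : BinaryTree Caret) : Equiv.Perm Square :=
  ofDiagram T (allRight T.numNodes) <|
    finCongr (T.numLeaves_eq_numNodes_succ.trans (numLeaves_allRight T.numNodes).symm)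

/-- The element that permutes the leaves of the all-right tree with `k` carets by `σ`. -/
def ofPerm (k : ℕ) (σ : Equiv.Perm (Fin (k + 1))) : Equiv.Perm Square :=
  ofDiagram (allRight k) (allRight k) <|
    ((finCongr (numLeaves_allRight k)).trans σ).trans (finCongr (numLeaves_allRight k).symm)

/-! ### The infinite generating set and words -/

/-- The letters `Aᵢ, Bᵢ, Cᵢ, Πᵢ, Π̄ᵢ`. -/
inductive Letter : Type
  | A (i : ℕ)
  | B (i : ℕ)
  | C (i : ℕ)
  | P (i : ℕ)
  | Pbar (i : ℕ)

/-- The all-right tree with `i + 1` vertical carets, with `t` hanging from leaf `i`. -/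
def attach : ℕ → BinaryTree Caret → BinaryTree Caret
  | 0, t => .node .vert t .nil
  | i + 1, t => .node .vert .nil (attach i t)

/-- The all-right tree with carets number `0, …, i`, of which only the last one is horizontal. -/
def squareEnd : ℕ → BinaryTree Caret
  | 0 => .node .horiz .nil .nil
  | i + 1 => .node .vert .nil (squareEnd i)

/-- The generators of `2V`. The last two interchange the leaves `i` and `i + 1` of the all-right tree
with `i + 3` leaves, respectively `i + 2` leaves. -/
def Letter.val : Letter → Equiv.Perm Square
  | .A i => ofTree (attach i (.node .vert .nil .nil))
  | .B i => ofTree (attach i (.node .horiz .nil .nil))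
  | .C i => ofTree (squareEnd i)
  | .P i => ofPerm (i + 2) (Equiv.swap ⟨i, by omega⟩ ⟨i + 1, by omega⟩)
  | .Pbar i => ofPerm (i + 1) (Equiv.swap ⟨i, by omega⟩ ⟨i + 1, by omega⟩)

/-- The element given by a word. Maps act on the right, so the leftmost letter is applied first. -/
def eval : List Letter → Equiv.Perm Square
  | [] => Equiv.refl Square
  | x :: w => x.val.trans (eval w)

/-- The word `A₀^{a 0} A₁^{a 1} ⋯ Aₙ^{a n}`. -/
def wordA (n : ℕ) (a : ℕ → ℕ) : List Letter :=
  (List.range (n + 1)).flatMap fun j => List.replicate (a j) (.A j)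

/-- The word `B_k^{b 0} B_{k+1}^{b 1} ⋯ B_{k+m}^{b m}`. -/
def wordB (k m : ℕ) (b : ℕ → ℕ) : List Letter :=
  (List.range (m + 1)).flatMap fun p => List.replicate (b p) (.B (k + p))

/-- The word `C_i C_{i+1} ⋯ C_{i+s-1}` with `s` letters. -/
def wordC (i s : ℕ) : List Letter := (List.range s).map fun t => .C (i + t)

/-- The word `A_k^e B_k^{b 0} B_{k+1}^{b 1} ⋯ B_{k+m}^{b m}`. -/
def block (k e m : ℕ) (b : ℕ → ℕ) : List Letter := List.replicate e (.A k) ++ wordB k m b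

/-- The concatenation of `C_i ⋯ C_{i+s-1}`, the `n` blocks with exponents `a j` and `b'`, and the
final block with exponents `a n` and `b`. -/
def gridWord (n m i s : ℕ) (a b b' : ℕ → ℕ) : List Letter :=
  wordC i s ++ ((List.range n).flatMap fun j => block ((m + 1) * j) (a j) m b') ++
    block ((m + 1) * n) (a n) m b

/-- `w` is a word of the form `gridWord` for trees with `n + 1` and `m + 1` leaves. -/
def IsGridWord (n m : ℕ) (w : List Letter) : Prop :=
  ∃ (i s : ℕ) (a b b' : ℕ → ℕ), w = gridWord n m i s a b b'

/-- `w` is a positive prefix word of `f`: a word of the grid form which is the positive element of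
the source tree of a reduced grid diagram of `f`. -/
def IsPrefixWord (f : Equiv.Perm Square) (w : List Letter) : Prop :=
  ∃ D : GridDiagram, D.IsReducedFor f ∧ IsGridWord D.Tv.numNodes D.Th.numNodes w ∧
    eval w = ofTree (gridTree D.Tv D.Th)

/-- The number of carets on the spine (the right side) of a tree. -/
def spineCarets : BinaryTree Unit → ℕ
  | .nil => 0
  | .node _ _ r => spineCarets r + 1

/-- The exponent of leaf `p` of a tree that hangs off the spine: the length of the maximal path of
left edges that goes up from the leaf. -/
def interiorExponent : BinaryTree Unit → ℕ → ℕ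
  | .nil, _ => 0
  | .node _ l r, p =>
    if p < l.numLeaves then interiorExponent l p + (if p = 0 then 1 else 0)
    else interiorExponent r (p - l.numLeaves)

/-- The exponent of leaf `p` of a tree on the spine: the length of the maximal path of left edges
that goes up from the leaf and does not reach the right side of the tree. -/
def spineExponent : BinaryTree Unit → ℕ → ℕ
  | .nil, _ => 0
  | .node _ l r, p =>
    if p < l.numLeaves then interiorExponent l p else spineExponent r (p - l.numLeaves)

/-- A positive word in standard form: letters `C` with increasing indices, followed by letters
`A` and `B` with nondecreasing indices. -/
def IsStandardPositive (w : List Letter) : Prop :=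
  ∃ (c : List ℕ) (x : List (Bool × ℕ)), c.Pairwise (· < ·) ∧ (x.map Prod.snd).Pairwise (· ≤ ·) ∧
    w = c.map .C ++ x.map fun y => if y.1 then .B y.2 else .A y.2

/-- A word in the letters `Πᵢ, Π̄ᵢ`. -/
def IsPermutationWord (w : List Letter) : Prop :=
  ∀ x ∈ w, ∃ i, x = .P i ∨ x = .Pbar i

end Thompson2V

namespace Thompson2V

/-! ### Points of the square relative to carets and to the right spine -/

/-! Everything is computed on points. A point is described by its place on the all-right tree:
`atLeaf k z` has first coordinate starting with 1^k 0, and `rightEnd k z` has first coordinate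
starting with 1^k. The letters `A`, `B`, `C` act on such points by explicit shifts. Hence a word
with one `C` for each horizontal spine caret, followed by one `A` or `B` for each caret off the
spine in preorder, is the element of the tree (`eval_treeWord`). A caret off the spine is recorded
at its leftmost leaf, so in a tree of one type the exponent of a leaf counts left edges above it;
for a grid tree this gives the grid word (`treeWord_gridTree`).

Words are unique because exponents can be read off the map. The first block of a word in `A`, `B` is
visible on the corner of leaf k with prefixes 0^α and 0^β, which goes affinely onto leaf k;
cancelling the block allows induction (`caretWord_injective`). The number of letters `C` is seen in
the second coordinate far out on the right end, and their first index in the order in which two test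
points end up (`wordC_eq_of_eval_append_eq`).

A reduced diagram exists because a grid with the fewest carets is reduced. It is unique because
every grid on which f is affine refines it: if f is affine on both halves of a rectangle and on a
strip crossing both, it is affine on the rectangle (`isAffineOn_of_vertical_halves`). The images of
the grid rectangles form a subdivision by halving because in dimension two every dyadic partition
other than the trivial one has a cut through the middle (`exists_tree_of_coverCount`). The
factorization of f follows by matching leaf numbers (`exists_eq_ofTree_trans_ofPerm`) and writing a
permutation with adjacent transpositions (`exists_permutationWord`). -/

/-- The point of one half of the square, given by its relative position in that half. -/
def join (c : Caret) (e : Bool) (z : Square) : Square := (halve c).symm (e, z)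

theorem join_cases (c : Caret) (z : Square) : ∃ e x, z = join c e x :=
  ⟨(halve c z).1, (halve c z).2, ((halve c).symm_apply_apply z).symm⟩

theorem join_inj {c : Caret} {e e' : Bool} {x x' : Square} (h : join c e x = join c e' x') :
    e = e' ∧ x = x' := by
  simpa [join] using h

theorem join_vert_join_horiz (d e : Bool) (z : Square) :
    join .vert d (join .horiz e z) = join .horiz e (join .vert d z) := rfl

theorem place_child (c : Caret) (e : Bool) (r : Rect) (z : Square) :
    Rect.place (c.child e r) z = join c e (Rect.place r z) := by
  cases c <;> rfl

theorem place_nil (z : Square) : Rect.place ([], []) z = z := rfl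

/-- The point of the last leaf of the all-right tree with `k` carets. -/
def rightEnd : ℕ → Square → Square
  | 0, z => z
  | k + 1, z => join .vert true (rightEnd k z)

/-- The point of leaf `k` of the all-right tree with more than `k` carets. -/
def atLeaf (k : ℕ) (z : Square) : Square := rightEnd k (join .vert false z)

theorem rightEnd_succ (k : ℕ) (z : Square) :
    rightEnd (k + 1) z = join .vert true (rightEnd k z) := rfl

theorem rightEnd_add (k j : ℕ) (z : Square) : rightEnd (k + j) z = rightEnd k (rightEnd j z) := by
  induction k with
  | zero => simp [rightEnd]
  | succ k ih => rw [Nat.succ_add, rightEnd_succ, ih, rightEnd_succ]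

theorem rightEnd_succ' (k : ℕ) (z : Square) :
    rightEnd (k + 1) z = rightEnd k (join .vert true z) := rightEnd_add k 1 z

theorem rightEnd_atLeaf (k j : ℕ) (z : Square) : rightEnd k (atLeaf j z) = atLeaf (k + j) z := by
  rw [atLeaf, atLeaf, rightEnd_add]

theorem rightEnd_inj {k : ℕ} {z z' : Square} (h : rightEnd k z = rightEnd k z') : z = z' := by
  induction k with
  | zero => exact h
  | succ k ih => exact ih (join_inj h).2

theorem atLeaf_inj {k : ℕ} {z z' : Square} (h : atLeaf k z = atLeaf k z') : z = z' :=
  (join_inj (rightEnd_inj h)).2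

theorem le_of_atLeaf_eq_rightEnd {j k : ℕ} {x y : Square} (h : atLeaf j x = rightEnd k y) :
    k ≤ j := by
  by_contra hlt
  obtain ⟨d, rfl⟩ : ∃ d, k = j + (d + 1) := ⟨k - j - 1, by omega⟩
  rw [rightEnd_add, atLeaf, rightEnd_succ] at h
  simpa using (join_inj (rightEnd_inj h)).1

/-- The point of leaf `p` of the all-right tree with `k` carets. -/
def spot (k p : ℕ) (z : Square) : Square := if p < k then atLeaf p z else rightEnd k z

theorem rightEnd_spot (j k p : ℕ) (z : Square) :
    rightEnd j (spot k p z) = spot (j + k) (j + p) z := by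
  simp only [spot, Nat.add_lt_add_iff_left]
  split_ifs
  · exact rightEnd_atLeaf j p z
  · exact (rightEnd_add j k z).symm

theorem spot_of_lt {k p : ℕ} (h : p < k) (z : Square) : spot k p z = atLeaf p z := if_pos h

theorem spot_self (k : ℕ) (z : Square) : spot k k z = rightEnd k z := if_neg (lt_irrefl k)

/-! ### The leaf containing a point -/

/-- The number of the leaf of `T` that contains the point. -/
def leafIndex (T : BinaryTree Caret) (z : Square) : ℕ := (locate T z).1

/-- The relative position of a point in its leaf of `T`. -/
def leafPos (T : BinaryTree Caret) (z : Square) : Square := (locate T z).2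

theorem leafIndex_lt (T : BinaryTree Caret) (z : Square) : leafIndex T z < T.numLeaves :=
  (locate T z).1.isLt

theorem locate_join_false (c : Caret) (l r : BinaryTree Caret) (x : Square) :
    locate (.node c l r) (join c false x) =
      (Fin.castAdd r.numLeaves (locate l x).1, (locate l x).2) := by
  cases c <;> rfl

theorem locate_join_true (c : Caret) (l r : BinaryTree Caret) (x : Square) :
    locate (.node c l r) (join c true x) =
      (Fin.natAdd l.numLeaves (locate r x).1, (locate r x).2) := by
  cases c <;> rfl

theorem leafIndex_join_false (c : Caret) (l r : BinaryTree Caret) (x : Square) :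
    leafIndex (.node c l r) (join c false x) = leafIndex l x := by
  rw [leafIndex, locate_join_false]; rfl

theorem leafIndex_join_true (c : Caret) (l r : BinaryTree Caret) (x : Square) :
    leafIndex (.node c l r) (join c true x) = l.numLeaves + leafIndex r x := by
  rw [leafIndex, locate_join_true]; rfl

theorem leafPos_join_false (c : Caret) (l r : BinaryTree Caret) (x : Square) :
    leafPos (.node c l r) (join c false x) = leafPos l x := by
  rw [leafPos, locate_join_false]; rfl

theorem leafPos_join_true (c : Caret) (l r : BinaryTree Caret) (x : Square) :
    leafPos (.node c l r) (join c true x) = leafPos r x := by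
  rw [leafPos, locate_join_true]; rfl

theorem length_leafRects (T : BinaryTree Caret) : (leafRects T).length = T.numLeaves := by
  induction T with
  | nil => rfl
  | node c l r ihl ihr => simp [leafRects, ihl, ihr]

/-- Links the two descriptions of leaves: the recursive bijection `locate` and the list `leafRects`.
-/
theorem exists_leafRect_place (T : BinaryTree Caret) (z : Square) :
    ∃ r, (leafRects T)[leafIndex T z]? = some r ∧ z = Rect.place r (leafPos T z) := by
  induction T generalizing z with
  | nil => exact ⟨_, rfl, rfl⟩
  | node c l r ihl ihr =>
    obtain ⟨e, x, rfl⟩ := join_cases c z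
    cases e
    · obtain ⟨q, hq, hx⟩ := ihl x
      refine ⟨c.child false q, ?_, ?_⟩
      · rw [leafIndex_join_false, leafRects, List.getElem?_append_left]
        · simp [hq]
        · simpa [length_leafRects] using leafIndex_lt l x
      · rw [leafPos_join_false, place_child, ← hx]
    · obtain ⟨q, hq, hx⟩ := ihr x
      refine ⟨c.child true q, ?_, ?_⟩
      · rw [leafIndex_join_true, leafRects, List.getElem?_append_right]
        · simp [hq, length_leafRects]
        · simp [length_leafRects]
      · rw [leafPos_join_true, place_child, ← hx]

theorem locate_symm_apply (T : BinaryTree Caret) (p : Fin T.numLeaves) (z : Square) :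
    (locate T).symm (p, z) =
      Rect.place ((leafRects T)[(p : ℕ)]'(by rw [length_leafRects]; exact p.isLt)) z := by
  obtain ⟨r, hr, hz⟩ := exists_leafRect_place T ((locate T).symm (p, z))
  have h1 : leafIndex T ((locate T).symm (p, z)) = p := by simp [leafIndex]
  have h2 : leafPos T ((locate T).symm (p, z)) = z := by simp [leafPos]
  rw [h1] at hr
  rw [h2] at hz
  rw [hz]
  congr 1
  exact (List.getElem_eq_iff _).2 hr |>.symm

theorem spot_leafIndex_allRight (k : ℕ) (z : Square) :
    spot k (leafIndex (allRight k) z) (leafPos (allRight k) z) = z := by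
  induction k generalizing z with
  | zero => rfl
  | succ k ih =>
    obtain ⟨e, x, rfl⟩ := join_cases .vert z
    cases e
    · rw [allRight, leafIndex_join_false, leafPos_join_false]; rfl
    · rw [allRight, leafIndex_join_true, leafPos_join_true]
      conv_rhs => rw [← ih x]
      rw [Nat.add_comm k 1]
      exact (rightEnd_spot 1 k _ _).symm

theorem locate_allRight_symm (k : ℕ) (p : Fin (allRight k).numLeaves) (z : Square) :
    (locate (allRight k)).symm (p, z) = spot k p z := by
  have h := spot_leafIndex_allRight k ((locate (allRight k)).symm (p, z))
  simpa [leafIndex, leafPos] using h.symm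

theorem ofTree_eq_spot (T : BinaryTree Caret) (z : Square) :
    ofTree T z = spot T.numNodes (leafIndex T z) (leafPos T z) := by
  simp only [ofTree, ofDiagram, Equiv.trans_apply]
  rw [Equiv.prodCongr_apply, Prod.map, locate_allRight_symm]
  rfl

theorem ofTree_nil (z : Square) : ofTree .nil z = z := by
  rw [ofTree_eq_spot]; rfl

theorem ofTree_join_false (c : Caret) (l r : BinaryTree Caret) (x : Square) :
    ofTree (.node c l r) (join c false x) = atLeaf (leafIndex l x) (leafPos l x) := by
  rw [ofTree_eq_spot, leafIndex_join_false, leafPos_join_false, spot_of_lt]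
  have := leafIndex_lt l x
  rw [l.numLeaves_eq_numNodes_succ] at this
  simp only [BinaryTree.numNodes]
  omega

theorem ofTree_join_true (c : Caret) (l r : BinaryTree Caret) (x : Square) :
    ofTree (.node c l r) (join c true x) = rightEnd l.numLeaves (ofTree r x) := by
  rw [ofTree_eq_spot, leafIndex_join_true, leafPos_join_true, ofTree_eq_spot, rightEnd_spot]
  congr 1
  rw [l.numLeaves_eq_numNodes_succ]
  simp only [BinaryTree.numNodes]
  omega

/-! ### The action of the positive letters -/

/-- The letter that adds a caret of the given type at leaf `k` off the spine. -/
def caretLetter : Caret → ℕ → Letter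
  | .vert, k => .A k
  | .horiz, k => .B k

theorem caretLetter_val (c : Caret) (k : ℕ) :
    (caretLetter c k).val = ofTree (attach k (.node c .nil .nil)) := by
  cases c <;> rfl

/-- Self-similarity along the spine: the part of `attach (j + k) t` below the j-th spine step is
`attach k t`. It reduces the action of each letter to index 0. -/
theorem caretLetter_rightEnd_le (c : Caret) (j k : ℕ) (z : Square) :
    (caretLetter c (j + k)).val (rightEnd j z) = rightEnd j ((caretLetter c k).val z) := by
  induction j with
  | zero => simp [rightEnd]
  | succ j ih =>
    rw [caretLetter_val] at ih ⊢
    rw [Nat.succ_add, attach, rightEnd_succ, ofTree_join_true, ih]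
    rfl

theorem caretLetter_atLeaf_of_lt (c : Caret) {j k : ℕ} (h : j < k) (z : Square) :
    (caretLetter c k).val (atLeaf j z) = atLeaf j z := by
  obtain ⟨d, rfl⟩ : ∃ d, k = j + (d + 1) := ⟨k - j - 1, by omega⟩
  rw [atLeaf, caretLetter_rightEnd_le, caretLetter_val, attach, ofTree_join_false]
  rfl

theorem caretLetter_atLeaf_false (c : Caret) (k : ℕ) (z : Square) :
    (caretLetter c k).val (atLeaf k (join c false z)) = atLeaf k z := by
  have := caretLetter_rightEnd_le c k 0 (join .vert false (join c false z))
  rw [Nat.add_zero] at this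
  rw [atLeaf, this, caretLetter_val, attach, ofTree_join_false, leafIndex_join_false,
    leafPos_join_false]
  rfl

theorem caretLetter_atLeaf_true (c : Caret) (k : ℕ) (z : Square) :
    (caretLetter c k).val (atLeaf k (join c true z)) = atLeaf (k + 1) z := by
  have := caretLetter_rightEnd_le c k 0 (join .vert false (join c true z))
  rw [Nat.add_zero] at this
  rw [atLeaf, this, caretLetter_val, attach, ofTree_join_false, leafIndex_join_true,
    leafPos_join_true, rightEnd_atLeaf]
  rfl

/-- The added caret splits leaf k in two, so everything to the right of that leaf moves by one
place. -/
theorem caretLetter_rightEnd_of_lt (c : Caret) {j k : ℕ} (h : k < j) (z : Square) :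
    (caretLetter c k).val (rightEnd j z) = rightEnd (j + 1) z := by
  obtain ⟨d, rfl⟩ : ∃ d, j = k + (d + 1) := ⟨j - k - 1, by omega⟩
  have := caretLetter_rightEnd_le c k 0 (rightEnd (d + 1) z)
  rw [Nat.add_zero] at this
  rw [rightEnd_add, this, caretLetter_val, attach, rightEnd_succ, ofTree_join_true, ofTree_nil,
    ← rightEnd_add, ← rightEnd_add]
  congr 1
  simp
  omega

theorem C_rightEnd_le (j k : ℕ) (z : Square) :
    (Letter.C (j + k)).val (rightEnd j z) = rightEnd j ((Letter.C k).val z) := by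
  induction j with
  | zero => simp [rightEnd]
  | succ j ih =>
    rw [Letter.val] at ih ⊢
    rw [Nat.succ_add, squareEnd, rightEnd_succ, ofTree_join_true, ih]
    rfl

theorem C_atLeaf_of_lt {j k : ℕ} (h : j < k) (z : Square) :
    (Letter.C k).val (atLeaf j z) = atLeaf j z := by
  obtain ⟨d, rfl⟩ : ∃ d, k = j + (d + 1) := ⟨k - j - 1, by omega⟩
  rw [atLeaf, C_rightEnd_le, Letter.val, squareEnd, ofTree_join_false]
  rfl

theorem C_rightEnd_false (k : ℕ) (z : Square) :
    (Letter.C k).val (rightEnd k (join .horiz false z)) = atLeaf k z := by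
  have := C_rightEnd_le k 0 (join .horiz false z)
  rw [Nat.add_zero] at this
  rw [this, Letter.val, squareEnd, ofTree_join_false, rightEnd_atLeaf]
  rfl

theorem C_rightEnd_true (k : ℕ) (z : Square) :
    (Letter.C k).val (rightEnd k (join .horiz true z)) = rightEnd (k + 1) z := by
  have := C_rightEnd_le k 0 (join .horiz true z)
  rw [Nat.add_zero] at this
  rw [this, Letter.val, squareEnd, ofTree_join_true, ofTree_nil, rightEnd_add]
  rfl

theorem eval_cons_apply (x : Letter) (w : List Letter) (z : Square) :
    eval (x :: w) z = eval w (x.val z) := rfl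

theorem eval_append (w w' : List Letter) : eval (w ++ w') = (eval w).trans (eval w') := by
  induction w with
  | nil => rfl
  | cons x w ih => simp only [List.cons_append, eval, ih]; rfl

theorem eval_append_apply (w w' : List Letter) (z : Square) :
    eval (w ++ w') z = eval w' (eval w z) := by
  rw [eval_append]; rfl

theorem eval_append_left_cancel {u w w' : List Letter} (h : eval (u ++ w) = eval (u ++ w')) :
    eval w = eval w' := by
  ext1 z
  have := Equiv.congr_fun h ((eval u).symm z)
  simpa [eval_append_apply] using this

/-! ### The word of a tree -/

/-- The word that adds the tree `T` at leaf `k` off the spine. -/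
def interiorWord : ℕ → BinaryTree Caret → List Letter
  | _, .nil => []
  | k, .node c l r => caretLetter c k :: (interiorWord k l ++ interiorWord (k + l.numLeaves) r)

/-- The word that adds the subtrees hanging off the spine of `T`, whose first leaf has
number `k`. -/
def spineWord : ℕ → BinaryTree Caret → List Letter
  | _, .nil => []
  | k, .node _ l r => interiorWord k l ++ spineWord (k + l.numLeaves) r

/-- The indices of the horizontal carets on the spine of `T`, counted from `i`. -/
def horizSpine : ℕ → BinaryTree Caret → List ℕ
  | _, .nil => []
  | i, .node .vert _ r => horizSpine (i + 1) r
  | i, .node .horiz _ r => i :: horizSpine (i + 1) r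

/-- The word of `T`: letters `C` for the spine, then the letters for the subtrees off the spine. -/
def treeWord (T : BinaryTree Caret) : List Letter :=
  (horizSpine 0 T).map .C ++ spineWord 0 T

theorem eval_interiorWord_atLeaf_of_lt (T : BinaryTree Caret) {j k : ℕ} (h : j < k) (z : Square) :
    eval (interiorWord k T) (atLeaf j z) = atLeaf j z := by
  induction T generalizing k with
  | nil => rfl
  | node c l r ihl ihr =>
    rw [interiorWord, eval_cons_apply, eval_append_apply, caretLetter_atLeaf_of_lt c h, ihl h,
      ihr (by omega)]

/-- Each caret of `T` pushes what lies to the right of leaf k by one place. -/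
theorem eval_interiorWord_rightEnd (T : BinaryTree Caret) {j k : ℕ} (h : k < j) (z : Square) :
    eval (interiorWord k T) (rightEnd j z) = rightEnd (j + T.numNodes) z := by
  induction T generalizing j k with
  | nil => rfl
  | node c l r ihl ihr =>
    have := l.numLeaves_eq_numNodes_succ
    rw [interiorWord, eval_cons_apply, eval_append_apply, caretLetter_rightEnd_of_lt c h,
      ihl (by omega), ihr (by omega)]
    simp only [BinaryTree.numNodes]
    congr 1
    omega

/-- The root letter sends the two halves of leaf k to leaves k and k + 1. Growing `l` at leaf k then
pushes the second half to leaf k + `l.numLeaves`, exactly where the word of `r` starts. -/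
theorem eval_interiorWord_atLeaf (T : BinaryTree Caret) (k : ℕ) (z : Square) :
    eval (interiorWord k T) (atLeaf k z) = atLeaf (k + leafIndex T z) (leafPos T z) := by
  induction T generalizing k z with
  | nil => rfl
  | node c l r ihl ihr =>
    rw [interiorWord, eval_cons_apply, eval_append_apply]
    obtain ⟨e, x, rfl⟩ := join_cases c z
    cases e
    · rw [caretLetter_atLeaf_false, ihl, leafIndex_join_false, leafPos_join_false,
        eval_interiorWord_atLeaf_of_lt _ (by have := leafIndex_lt l x; omega)]
    · rw [caretLetter_atLeaf_true, leafIndex_join_true, leafPos_join_true, atLeaf,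
        eval_interiorWord_rightEnd _ (by omega), ← atLeaf, Nat.add_assoc, Nat.add_comm 1,
        ← l.numLeaves_eq_numNodes_succ, ihr, Nat.add_assoc]

/-- The place of a point of `T` after straightening the spine of `T`. -/
def straighten : BinaryTree Caret → Square → Square
  | .nil, z => z
  | .node c _ r, z => if (halve c z).1 then join .vert true (straighten r (halve c z).2)
      else join .vert false (halve c z).2

theorem straighten_join_false (c : Caret) (l r : BinaryTree Caret) (x : Square) :
    straighten (.node c l r) (join c false x) = atLeaf 0 x := by
  simp [straighten, join, atLeaf, rightEnd]

theorem straighten_join_true (c : Caret) (l r : BinaryTree Caret) (x : Square) :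
    straighten (.node c l r) (join c true x) = rightEnd 1 (straighten r x) := by
  simp [straighten, join, rightEnd]

theorem eval_horizSpine_atLeaf (T : BinaryTree Caret) {i j : ℕ} (h : j < i) (z : Square) :
    eval ((horizSpine i T).map .C) (atLeaf j z) = atLeaf j z := by
  induction T generalizing i with
  | nil => rfl
  | node c l r _ ihr =>
    cases c
    · exact ihr (by omega)
    · rw [horizSpine, List.map_cons, eval_cons_apply, C_atLeaf_of_lt h, ihr (by omega)]

/-- A vertical spine caret is already in place and needs no letter; a horizontal one at depth i is
made vertical by `C i`. Subtrees off the spine are carried along unchanged. -/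
theorem eval_horizSpine_rightEnd (T : BinaryTree Caret) (i : ℕ) (z : Square) :
    eval ((horizSpine i T).map .C) (rightEnd i z) = rightEnd i (straighten T z) := by
  induction T generalizing i z with
  | nil => rfl
  | node c l r _ ihr =>
    obtain ⟨e, x, rfl⟩ := join_cases c z
    cases e
    · rw [straighten_join_false, rightEnd_atLeaf]
      cases c
      · rw [horizSpine]
        exact eval_horizSpine_atLeaf r (Nat.lt_succ_self i) x
      · rw [horizSpine, List.map_cons, eval_cons_apply, C_rightEnd_false]
        exact eval_horizSpine_atLeaf r (Nat.lt_succ_self i) x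
    · rw [straighten_join_true, ← rightEnd_add, ← ihr]
      cases c
      · rw [horizSpine, rightEnd_succ']
      · rw [horizSpine, List.map_cons, eval_cons_apply, C_rightEnd_true]

theorem eval_spineWord_atLeaf (T : BinaryTree Caret) {j k : ℕ} (h : j < k) (z : Square) :
    eval (spineWord k T) (atLeaf j z) = atLeaf j z := by
  induction T generalizing k with
  | nil => rfl
  | node c l r _ ihr =>
    rw [spineWord, eval_append_apply, eval_interiorWord_atLeaf_of_lt l h, ihr (by omega)]

theorem eval_spineWord_straighten (T : BinaryTree Caret) (k : ℕ) (z : Square) :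
    eval (spineWord k T) (rightEnd k (straighten T z)) = rightEnd k (ofTree T z) := by
  induction T generalizing k z with
  | nil => rw [ofTree_nil]; rfl
  | node c l r _ ihr =>
    rw [spineWord, eval_append_apply]
    obtain ⟨e, x, rfl⟩ := join_cases c z
    cases e
    · rw [straighten_join_false, rightEnd_atLeaf, ofTree_join_false, rightEnd_atLeaf,
        Nat.add_zero, eval_interiorWord_atLeaf, eval_spineWord_atLeaf]
      have := leafIndex_lt l x
      omega
    · rw [straighten_join_true, ← rightEnd_add, ofTree_join_true, ← rightEnd_add,
        eval_interiorWord_rightEnd _ (by omega), Nat.add_assoc, Nat.add_comm 1,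
        ← l.numLeaves_eq_numNodes_succ, ihr]

theorem eval_treeWord (T : BinaryTree Caret) : eval (treeWord T) = ofTree T := by
  ext1 z
  rw [treeWord, eval_append_apply]
  exact (congrArg _ (eval_horizSpine_rightEnd T 0 z)).trans (eval_spineWord_straighten T 0 z)

/-! ### Standard form of the word of a tree -/

theorem le_of_mem_horizSpine (T : BinaryTree Caret) {i k : ℕ} (h : k ∈ horizSpine i T) : i ≤ k := by
  induction T generalizing i with
  | nil => simp [horizSpine] at h
  | node c l r _ ihr =>
    cases c
    · have := ihr h; omega
    · rcases List.mem_cons.1 h with rfl | h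
      · exact le_rfl
      · have := ihr h; omega

theorem pairwise_horizSpine (T : BinaryTree Caret) (i : ℕ) :
    (horizSpine i T).Pairwise (· < ·) := by
  induction T generalizing i with
  | nil => exact .nil
  | node c l r _ ihr =>
    cases c
    · exact ihr (i + 1)
    · exact .cons (fun k hk => le_of_mem_horizSpine r hk) (ihr (i + 1))

/-- A word of letters `A`, `B` with nondecreasing indices in the interval `[k, k']`. -/
def IsSortedIn (k k' : ℕ) (w : List Letter) : Prop :=
  ∃ x : List (Bool × ℕ), (x.map Prod.snd).Pairwise (· ≤ ·) ∧ (∀ y ∈ x, k ≤ y.2 ∧ y.2 ≤ k') ∧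
    w = x.map fun y => if y.1 then .B y.2 else .A y.2

theorem isSortedIn_nil (k k' : ℕ) : IsSortedIn k k' [] := ⟨[], by simp⟩

theorem isSortedIn_caretLetter (c : Caret) (k : ℕ) : IsSortedIn k k [caretLetter c k] := by
  cases c
  · exact ⟨[(false, k)], by simp [caretLetter]⟩
  · exact ⟨[(true, k)], by simp [caretLetter]⟩

theorem IsSortedIn.append {k₁ k₂ k₃ k₄ : ℕ} {w w' : List Letter} (h : IsSortedIn k₁ k₂ w)
    (h' : IsSortedIn k₃ k₄ w') (h₁₃ : k₁ ≤ k₃) (h₂₃ : k₂ ≤ k₃) (h₂₄ : k₂ ≤ k₄) :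
    IsSortedIn k₁ k₄ (w ++ w') := by
  obtain ⟨x, hx, hb, rfl⟩ := h
  obtain ⟨x', hx', hb', rfl⟩ := h'
  refine ⟨x ++ x', ?_, ?_, by simp⟩
  · rw [List.map_append, List.pairwise_append]
    refine ⟨hx, hx', ?_⟩
    simp only [List.mem_map]
    rintro _ ⟨y, hy, rfl⟩ _ ⟨y', hy', rfl⟩
    have := hb y hy
    have := hb' y' hy'
    omega
  · intro y hy
    rcases List.mem_append.1 hy with hy | hy
    · have := hb y hy; omega
    · have := hb' y hy; omega

/-- Preorder never returns to a smaller leaf number: the word of `l` stays below k + `l.numLeaves`,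
where the word of `r` begins. -/
theorem isSortedIn_interiorWord (T : BinaryTree Caret) (k : ℕ) :
    IsSortedIn k (k + T.numNodes) (interiorWord k T) := by
  induction T generalizing k with
  | nil => exact isSortedIn_nil _ _
  | node c l r ihl ihr =>
    have := l.numLeaves_eq_numNodes_succ
    have h := (isSortedIn_caretLetter c k).append ((ihl k).append (ihr (k + l.numLeaves))
      (by omega) (by omega) (by omega)) le_rfl le_rfl (by omega)
    rwa [show k + (BinaryTree.node c l r).numNodes = k + l.numLeaves + r.numNodes by
      simp only [BinaryTree.numNodes]; omega]

theorem isSortedIn_spineWord (T : BinaryTree Caret) (k : ℕ) :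
    IsSortedIn k (k + T.numNodes) (spineWord k T) := by
  induction T generalizing k with
  | nil => exact isSortedIn_nil _ _
  | node c l r _ ihr =>
    have := l.numLeaves_eq_numNodes_succ
    have h := (isSortedIn_interiorWord l k).append (ihr (k + l.numLeaves))
      (by omega) (by omega) (by omega)
    rwa [show k + (BinaryTree.node c l r).numNodes = k + l.numLeaves + r.numNodes by
      simp only [BinaryTree.numNodes]; omega]

theorem isStandardPositive_treeWord (T : BinaryTree Caret) : IsStandardPositive (treeWord T) := by
  obtain ⟨x, hx, -, h⟩ := isSortedIn_spineWord T 0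
  exact ⟨horizSpine 0 T, x, pairwise_horizSpine T 0, hx, by rw [treeWord, h]⟩

/-! ### The words of grid trees -/

theorem numNodes_paint (c : Caret) (T : BinaryTree Unit) : (paint c T).numNodes = T.numNodes := by
  induction T with
  | nil => rfl
  | node v l r ihl ihr => exact congrArg₂ (· + · + 1) ihl ihr

theorem numLeaves_paint (c : Caret) (T : BinaryTree Unit) :
    (paint c T).numLeaves = T.numLeaves := by
  rw [BinaryTree.numLeaves_eq_numNodes_succ, BinaryTree.numLeaves_eq_numNodes_succ, numNodes_paint]

theorem numLeaves_hang (T H : BinaryTree Caret) :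
    (hang T H).numLeaves = H.numLeaves * T.numLeaves := by
  induction T with
  | nil => simp [hang]
  | node c l r ihl ihr => simp [hang, ihl, ihr, Nat.mul_add]

theorem flatMap_range_add {α : Type*} (n m : ℕ) (g : ℕ → List α) :
    (List.range (n + m)).flatMap g =
      (List.range n).flatMap g ++ (List.range m).flatMap fun j => g (n + j) := by
  simp [List.range_add, List.flatMap_map]

theorem flatMap_range_congr {α : Type*} {n : ℕ} {g g' : ℕ → List α} (h : ∀ j < n, g j = g' j) :
    (List.range n).flatMap g = (List.range n).flatMap g' := by
  have : (List.range n).map g = (List.range n).map g' :=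
    List.map_congr_left fun j hj => h j (List.mem_range.1 hj)
  rw [List.flatMap_def, List.flatMap_def, this]

/-- The word of a tree painted with one colour, from whose leaves copies of `H` hang. -/
theorem interiorWord_hang_paint (c : Caret) (T : BinaryTree Unit) (H : BinaryTree Caret) (k : ℕ) :
    interiorWord k (hang (paint c T) H) = (List.range T.numLeaves).flatMap fun j =>
      List.replicate (interiorExponent T j) (caretLetter c (k + H.numLeaves * j)) ++
        interiorWord (k + H.numLeaves * j) H := by
  induction T generalizing k with
  | nil => simp [paint, BinaryTree.map, hang, interiorExponent]
  | node v l r ihl ihr =>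
    have hl : (hang (paint c l) H).numLeaves = H.numLeaves * l.numLeaves := by
      rw [numLeaves_hang, numLeaves_paint]
    have e : interiorWord k (hang (paint c (.node v l r)) H) = caretLetter c k ::
      (interiorWord k (hang (paint c l) H) ++
        interiorWord (k + (hang (paint c l) H).numLeaves) (hang (paint c r) H)) := rfl
    rw [e, hl, ihl, ihr, BinaryTree.numLeaves, flatMap_range_add, ← List.cons_append]
    congr 1
    -- The root letter belongs to leaf 0, so that leaf is split off the range; its exponent grows by
    -- one and all others are unchanged.
    · obtain ⟨d, hd⟩ : ∃ d, l.numLeaves = 1 + d := ⟨l.numNodes, by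
        rw [l.numLeaves_eq_numNodes_succ, Nat.add_comm]⟩
      have h0 : interiorExponent (.node v l r) 0 = interiorExponent l 0 + 1 := by
        simp [interiorExponent, l.numLeaves_pos]
      rw [hd, flatMap_range_add, flatMap_range_add, ← List.cons_append]
      congr 1
      · simp [h0, List.replicate_succ]
      · refine flatMap_range_congr fun j hj => ?_
        simp [interiorExponent, hd, hj]
    · refine flatMap_range_congr fun j hj => ?_
      simp [interiorExponent, Nat.mul_add, Nat.add_assoc]

theorem hang_nil (T : BinaryTree Caret) : hang T .nil = T := by
  induction T with
  | nil => rfl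
  | node c l r ihl ihr => rw [hang, ihl, ihr]

theorem interiorWord_paint (c : Caret) (T : BinaryTree Unit) (k : ℕ) :
    interiorWord k (paint c T) = (List.range T.numLeaves).flatMap fun j =>
      List.replicate (interiorExponent T j) (caretLetter c (k + j)) := by
  have := interiorWord_hang_paint c T .nil k
  simpa [hang_nil, interiorWord] using this

/-- Only the copy of `H` at the last leaf, number `T.numNodes`, continues the spine; all other
copies hang off it. This is the source of the two kinds of exponents in a grid word. -/
theorem spineWord_hang_paint (c : Caret) (T : BinaryTree Unit) (H : BinaryTree Caret) (k : ℕ) :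
    spineWord k (hang (paint c T) H) = ((List.range T.numNodes).flatMap fun j =>
      List.replicate (spineExponent T j) (caretLetter c (k + H.numLeaves * j)) ++
        interiorWord (k + H.numLeaves * j) H) ++
      (List.replicate (spineExponent T T.numNodes) (caretLetter c (k + H.numLeaves * T.numNodes)) ++
        spineWord (k + H.numLeaves * T.numNodes) H) := by
  induction T generalizing k with
  | nil => simp [paint, BinaryTree.map, hang, spineExponent]
  | node v l r _ ihr =>
    have hl : (hang (paint c l) H).numLeaves = H.numLeaves * l.numLeaves := by
      rw [numLeaves_hang, numLeaves_paint]
    have e : spineWord k (hang (paint c (.node v l r)) H) =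
      (interiorWord k (hang (paint c l) H) ++
        spineWord (k + (hang (paint c l) H).numLeaves) (hang (paint c r) H)) := rfl
    have hn : (BinaryTree.node v l r).numNodes = l.numLeaves + r.numNodes := by
      rw [l.numLeaves_eq_numNodes_succ, BinaryTree.numNodes]; omega
    rw [e, hl, interiorWord_hang_paint, ihr, hn, flatMap_range_add, List.append_assoc]
    congr 1
    · refine flatMap_range_congr fun j hj => ?_
      simp [spineExponent, hj]
    · simp [spineExponent, Nat.mul_add, Nat.add_assoc]

theorem spineWord_paint (c : Caret) (T : BinaryTree Unit) (k : ℕ) :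
    spineWord k (paint c T) = (List.range (T.numNodes + 1)).flatMap fun j =>
      List.replicate (spineExponent T j) (caretLetter c (k + j)) := by
  have := spineWord_hang_paint c T .nil k
  simpa [hang_nil, interiorWord, spineWord, List.range_succ] using this

/-- The vertical spine of `T` yields no letter but occupies the first depths, which is why the
letters `C` of a grid word start at the number of spine carets of the vertical tree. -/
theorem horizSpine_hang_paint_vert (T : BinaryTree Unit) (H : BinaryTree Caret) (i : ℕ) :
    horizSpine i (hang (paint .vert T) H) = horizSpine (i + spineCarets T) H := by
  induction T generalizing i with
  | nil => rfl
  | node v l r _ ihr =>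
    have e : horizSpine i (hang (paint .vert (.node v l r)) H) =
      horizSpine (i + 1) (hang (paint .vert r) H) := rfl
    rw [e, ihr, spineCarets, Nat.add_assoc, Nat.add_comm 1]

theorem horizSpine_paint_horiz (T : BinaryTree Unit) (i : ℕ) :
    (horizSpine i (paint .horiz T)).map .C = wordC i (spineCarets T) := by
  induction T generalizing i with
  | nil => rfl
  | node v l r _ ihr =>
    have e : horizSpine i (paint .horiz (.node v l r)) =
      i :: horizSpine (i + 1) (paint .horiz r) := rfl
    rw [e, List.map_cons, ihr, wordC, wordC, spineCarets, List.range_succ_eq_map]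
    simp [Function.comp_def, Nat.add_assoc, Nat.add_comm 1]

theorem horizSpine_paint_vert (T : BinaryTree Unit) (i : ℕ) :
    horizSpine i (paint .vert T) = [] := by
  have := horizSpine_hang_paint_vert T .nil i
  rwa [hang_nil] at this

theorem treeWord_paint_vert (T : BinaryTree Unit) :
    treeWord (paint .vert T) = wordA T.numNodes (spineExponent T) := by
  simp [treeWord, horizSpine_paint_vert, spineWord_paint, wordA, caretLetter]

theorem treeWord_paint_horiz (T : BinaryTree Unit) :
    treeWord (paint .horiz T) =
      wordC 0 (spineCarets T) ++ wordB 0 T.numNodes (spineExponent T) := by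
  simp [treeWord, horizSpine_paint_horiz, spineWord_paint, wordB, caretLetter]

theorem treeWord_node_paint_horiz (T : BinaryTree Unit) :
    treeWord (.node .vert (paint .horiz T) .nil) = wordB 0 T.numNodes (interiorExponent T) := by
  simp [treeWord, horizSpine, spineWord, interiorWord_paint, wordB, caretLetter,
    T.numLeaves_eq_numNodes_succ]

theorem treeWord_gridTree (Tv Th : BinaryTree Unit) :
    treeWord (gridTree Tv Th) = gridWord Tv.numNodes Th.numNodes (spineCarets Tv) (spineCarets Th)
      (spineExponent Tv) (spineExponent Th) (interiorExponent Th) := by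
  simp [treeWord, gridTree, horizSpine_hang_paint_vert, horizSpine_paint_horiz,
    spineWord_hang_paint, gridWord, block, wordB, interiorWord_paint, spineWord_paint, caretLetter,
    numLeaves_paint, Th.numLeaves_eq_numNodes_succ]

/-- The two exponents differ only in whether the left edge ending on the spine is counted, and a
leaf has at most one such edge on its path. -/
theorem interiorExponent_eq_or (T : BinaryTree Unit) (p : ℕ) :
    interiorExponent T p = spineExponent T p ∨ interiorExponent T p = spineExponent T p + 1 := by
  induction T generalizing p with
  | nil => exact .inl rfl
  | node v l r _ ihr =>
    simp only [interiorExponent, spineExponent]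
    split_ifs
    · exact .inr rfl
    · exact .inl rfl
    · exact ihr _

/-! ### Uniqueness of words -/

theorem eq_nil_of_forall_append_eq {u : List Bool}
    (h : ∀ x : Stream' Bool, Stream'.appendStream' u x = x) : u = [] := by
  cases u with
  | nil => rfl
  | cons a u =>
    -- A stream starting with the digit opposite to `a` cannot be fixed.
    have := congrArg Stream'.head (h (Stream'.const !a))
    rw [Stream'.cons_append_stream, Stream'.head_cons] at this
    cases a <;> cases this

theorem eq_of_forall_append_eq {u v : List Bool}
    (h : ∀ x : Stream' Bool, Stream'.appendStream' u x = Stream'.appendStream' v x) : u = v := by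
  wlog hl : u.length ≤ v.length generalizing u v
  · exact (this (fun x => (h x).symm) (by omega)).symm
  obtain ⟨w, rfl⟩ := exists_append_of_stream (h (Stream'.const false)) hl
  have : w = [] := eq_nil_of_forall_append_eq fun x => by
    have hx := h x
    rw [Stream'.append_append_stream] at hx
    have := congrArg (Stream'.drop u.length) hx
    rw [Stream'.drop_append_stream, Stream'.drop_append_stream] at this
    exact this.symm
  simp [this]

theorem place_injective_rect {r r' : Rect} (h : ∀ z, Rect.place r z = Rect.place r' z) : r = r' :=
  Prod.ext
    (eq_of_forall_append_eq fun x => congrArg Prod.fst (h (x, x)))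
    (eq_of_forall_append_eq fun x => congrArg Prod.snd (h (x, x)))

/-- The word of carets `A_k^{α k} B_k^{β k}` for `k` from `k₀` to `k₀ + N - 1`. -/
def caretWord (k₀ N : ℕ) (α β : ℕ → ℕ) : List Letter :=
  (List.range N).flatMap fun j =>
    List.replicate (α (k₀ + j)) (.A (k₀ + j)) ++ List.replicate (β (k₀ + j)) (.B (k₀ + j))

theorem caretWord_succ (k N : ℕ) (α β : ℕ → ℕ) : caretWord k (N + 1) α β =
    List.replicate (α k) (.A k) ++ List.replicate (β k) (.B k) ++ caretWord (k + 1) N α β := by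
  simp [caretWord, List.range_succ_eq_map, List.flatMap_map, Nat.add_assoc, Nat.add_comm 1]

theorem caretWord_congr {k N : ℕ} {α β α' β' : ℕ → ℕ}
    (h : ∀ j, k ≤ j → j < k + N → α j = α' j ∧ β j = β' j) :
    caretWord k N α β = caretWord k N α' β' :=
  flatMap_range_congr fun j hj => by
    rw [(h (k + j) (by omega) (by omega)).1, (h (k + j) (by omega) (by omega)).2]

/-- The letters of `w` add carets off the spine, at leaves with numbers at least `k`. -/
def IsCaretWord (k : ℕ) (w : List Letter) : Prop := ∀ x ∈ w, ∃ c j, k ≤ j ∧ x = caretLetter c j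

theorem isCaretWord_caretWord {k k₀ : ℕ} (h : k ≤ k₀) (N : ℕ) (α β : ℕ → ℕ) :
    IsCaretWord k (caretWord k₀ N α β) := by
  intro x hx
  simp only [caretWord, List.mem_flatMap, List.mem_append, List.mem_replicate] at hx
  obtain ⟨j, -, ⟨-, rfl⟩ | ⟨-, rfl⟩⟩ := hx
  · exact ⟨.vert, k₀ + j, by omega, rfl⟩
  · exact ⟨.horiz, k₀ + j, by omega, rfl⟩

theorem IsCaretWord.eval_atLeaf {k j : ℕ} {w : List Letter} (h : IsCaretWord k w) (hj : j < k)
    (z : Square) : eval w (atLeaf j z) = atLeaf j z := by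
  induction w with
  | nil => rfl
  | cons x w ih =>
    obtain ⟨c, i, hi, rfl⟩ := h x (by simp)
    rw [eval_cons_apply, caretLetter_atLeaf_of_lt c (by omega)]
    exact ih fun y hy => h y (by simp [hy])

theorem eval_replicate_A (e k : ℕ) (z : Square) :
    eval (List.replicate e (.A k)) (atLeaf k (Rect.place (List.replicate e false, []) z)) =
      atLeaf k z := by
  induction e with
  | zero => rfl
  | succ e ih =>
    have : Rect.place (List.replicate (e + 1) false, []) z =
      join .vert false (Rect.place (List.replicate e false, []) z) := rfl
    rw [List.replicate_succ, eval_cons_apply, this]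
    exact (congrArg _ (caretLetter_atLeaf_false .vert k _)).trans ih

theorem eval_replicate_B (e k : ℕ) (z : Square) :
    eval (List.replicate e (.B k)) (atLeaf k (Rect.place ([], List.replicate e false) z)) =
      atLeaf k z := by
  induction e with
  | zero => rfl
  | succ e ih =>
    have : Rect.place ([], List.replicate (e + 1) false) z =
      join .horiz false (Rect.place ([], List.replicate e false) z) := rfl
    rw [List.replicate_succ, eval_cons_apply, this]
    exact (congrArg _ (caretLetter_atLeaf_false .horiz k _)).trans ih

theorem eval_caretWord_atLeaf (k N : ℕ) (α β : ℕ → ℕ) (z : Square) :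
    eval (caretWord k (N + 1) α β)
      (atLeaf k (Rect.place (List.replicate (α k) false, List.replicate (β k) false) z)) =
      atLeaf k z := by
  have : Rect.place (List.replicate (α k) false, List.replicate (β k) false) z =
    Rect.place (List.replicate (α k) false, [])
      (Rect.place ([], List.replicate (β k) false) z) := rfl
  rw [caretWord_succ, eval_append_apply, eval_append_apply, this, eval_replicate_A,
    eval_replicate_B, (isCaretWord_caretWord le_rfl N α β).eval_atLeaf (Nat.lt_succ_self k)]

/-- Both maps send a corner of leaf k affinely onto the whole leaf. By injectivity the two corners
coincide as rectangles, and their side lengths give both exponents; the block at k then cancels. -/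
theorem caretWord_injective {k N : ℕ} {α β α' β' : ℕ → ℕ}
    (h : eval (caretWord k N α β) = eval (caretWord k N α' β')) :
    ∀ j, k ≤ j → j < k + N → α j = α' j ∧ β j = β' j := by
  induction N generalizing k with
  | zero => intro j h1 h2; omega
  | succ N ih =>
    have hk : α k = α' k ∧ β k = β' k := by
      have := place_injective_rect fun z => atLeaf_inj <|
        (eval (caretWord k (N + 1) α β)).injective <|
          (eval_caretWord_atLeaf k N α β z).trans <| by
            rw [h, eval_caretWord_atLeaf k N α' β' z]
      rw [Prod.mk.injEq] at this
      exact ⟨by simpa using congrArg List.length this.1, by simpa using congrArg List.length this.2⟩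
    intro j h1 h2
    rcases Nat.eq_or_lt_of_le h1 with rfl | h1
    · exact hk
    · rw [caretWord_succ, caretWord_succ, hk.1, hk.2] at h
      exact ih (eval_append_left_cancel h) j h1 (by omega)

theorem wordA_eq_caretWord (n : ℕ) (a : ℕ → ℕ) : wordA n a = caretWord 0 (n + 1) a 0 := by
  simp [wordA, caretWord]

theorem wordB_zero_eq_caretWord (m : ℕ) (b : ℕ → ℕ) : wordB 0 m b = caretWord 0 (m + 1) 0 b := by
  simp [wordB, caretWord]

theorem wordA_injective {n : ℕ} {a a' : ℕ → ℕ} (h : eval (wordA n a) = eval (wordA n a')) :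
    ∀ j ≤ n, a j = a' j := fun j hj => by
  rw [wordA_eq_caretWord, wordA_eq_caretWord] at h
  exact (caretWord_injective h j (by omega) (by omega)).1

theorem wordB_injective {m : ℕ} {b b' : ℕ → ℕ} (h : eval (wordB 0 m b) = eval (wordB 0 m b')) :
    ∀ p ≤ m, b p = b' p := fun p hp => by
  rw [wordB_zero_eq_caretWord, wordB_zero_eq_caretWord] at h
  exact (caretWord_injective h p (by omega) (by omega)).2

theorem flatMap_range_mul {α : Type*} (m n : ℕ) (g : ℕ → List α) :
    (List.range (m * n)).flatMap g =
      (List.range n).flatMap fun j => (List.range m).flatMap fun p => g (m * j + p) := by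
  induction n with
  | zero => simp
  | succ n ih => rw [Nat.mul_succ, flatMap_range_add, flatMap_range_add, ih]; simp

theorem block_eq_flatMap (k e m : ℕ) (b : ℕ → ℕ) : block k e m b =
    (List.range (m + 1)).flatMap fun p =>
      List.replicate (if p = 0 then e else 0) (.A (k + p)) ++
        List.replicate (b p) (.B (k + p)) := by
  simp [block, wordB, List.range_succ_eq_map, List.flatMap_map]

/-- The part of a grid word after the letters `C`. -/
theorem gridWord_eq_caretWord (n m i s : ℕ) (a b b' : ℕ → ℕ) :
    ∃ α β, gridWord n m i s a b b' = wordC i s ++ caretWord 0 ((m + 1) * (n + 1)) α β := by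
  -- Leaf k of the grid tree is leaf `k % (m + 1)` of copy number `k / (m + 1)` of the horizontal
  -- tree. Letters `A` occur only at the first leaf of a copy, and copy n is the one on the spine.
  refine ⟨fun k => if k % (m + 1) = 0 then a (k / (m + 1)) else 0,
    fun k => if k / (m + 1) < n then b' (k % (m + 1)) else b (k % (m + 1)), ?_⟩
  rw [gridWord, caretWord, flatMap_range_mul, List.append_assoc, flatMap_range_add]
  congr 2
  · refine flatMap_range_congr fun j hj => ?_
    rw [block_eq_flatMap]
    refine flatMap_range_congr fun p hp => ?_
    have h1 : ((m + 1) * j + p) % (m + 1) = p := by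
      rw [Nat.mul_add_mod, Nat.mod_eq_of_lt hp]
    have h2 : ((m + 1) * j + p) / (m + 1) = j := by
      rw [Nat.mul_add_div (by omega), Nat.div_eq_of_lt hp, Nat.add_zero]
    simp [h1, h2, hj]
  · rw [block_eq_flatMap]
    simp only [List.range_one, List.flatMap_cons, List.flatMap_nil, List.append_nil]
    refine flatMap_range_congr fun p hp => ?_
    have h1 : ((m + 1) * n + p) % (m + 1) = p := by
      rw [Nat.mul_add_mod, Nat.mod_eq_of_lt hp]
    have h2 : ((m + 1) * n + p) / (m + 1) = n := by
      rw [Nat.mul_add_div (by omega), Nat.div_eq_of_lt hp, Nat.add_zero]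
    simp [h1, h2]

/-! ### Recovering the letters `C` from the map -/

theorem wordC_succ (i s : ℕ) : wordC i (s + 1) = .C i :: wordC (i + 1) s := by
  simp [wordC, List.range_succ_eq_map, Function.comp_def, Nat.add_assoc, Nat.add_comm 1]

theorem eval_wordC_atLeaf {i j : ℕ} (h : j < i) (s : ℕ) (z : Square) :
    eval (wordC i s) (atLeaf j z) = atLeaf j z := by
  induction s generalizing i with
  | zero => rfl
  | succ s ih => rw [wordC_succ, eval_cons_apply, C_atLeaf_of_lt h, ih (by omega)]

theorem exists_eval_wordC_rightEnd {i j : ℕ} (h : j ≤ i) (s : ℕ) (z : Square) :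
    ∃ x, eval (wordC i s) (rightEnd j z) = rightEnd j x := by
  induction s generalizing i z with
  | zero => exact ⟨z, rfl⟩
  | succ s ih =>
    obtain ⟨d, rfl⟩ := Nat.exists_eq_add_of_le h
    rw [wordC_succ, eval_cons_apply, C_rightEnd_le]
    exact ih (by omega) _

theorem join_horiz_rightEnd (e : Bool) (k : ℕ) (z : Square) :
    join .horiz e (rightEnd k z) = rightEnd k (join .horiz e z) := by
  induction k with
  | zero => rfl
  | succ k ih => rw [rightEnd_succ, ← join_vert_join_horiz, ih, rightEnd_succ]

/-- Each letter turns one leading 1 of the second coordinate into a leading 1 of the first. -/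
theorem eval_wordC_corner {i K : ℕ} (h : i ≤ K) (s : ℕ) (z : Square) :
    eval (wordC i s) (rightEnd K (Rect.place ([], List.replicate s true) z)) =
      rightEnd (K + s) z := by
  induction s generalizing i K with
  | zero => rfl
  | succ s ih =>
    have e : Rect.place ([], List.replicate (s + 1) true) z =
      join .horiz true (Rect.place ([], List.replicate s true) z) := rfl
    obtain ⟨d, rfl⟩ := Nat.exists_eq_add_of_le h
    rw [wordC_succ, eval_cons_apply, e, rightEnd_add, ← join_horiz_rightEnd, C_rightEnd_true,
      ← rightEnd_add, ih (by omega)]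
    congr 1
    omega

/-- Beyond all indices in the word, every letter just adds a 1 to the first coordinate, so the
second coordinate is not affected. -/
theorem IsCaretWord.exists_eval_rightEnd {k : ℕ} {w : List Letter} (h : IsCaretWord k w) :
    ∃ K₀, ∀ K ≥ K₀, ∀ z, eval w (rightEnd K z) = rightEnd (K + w.length) z := by
  induction w with
  | nil => exact ⟨0, fun _ _ _ => rfl⟩
  | cons x w ih =>
    obtain ⟨c, j, -, rfl⟩ := h x (by simp)
    obtain ⟨K₀, hK⟩ := ih fun y hy => h y (by simp [hy])
    refine ⟨max K₀ (j + 1), fun K hK' z => ?_⟩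
    rw [eval_cons_apply, caretLetter_rightEnd_of_lt c (by omega), hK _ (by omega),
      List.length_cons]
    congr 1
    omega

/-- The first point has fewer leading ones in its first coordinate. -/
def LeadLT (z z' : Square) : Prop := ∃ j x x', z = atLeaf j x ∧ z' = rightEnd (j + 1) x'

theorem LeadLT.asymm {z z' : Square} (h : LeadLT z z') : ¬ LeadLT z' z := by
  rintro ⟨j', y, y', h1, h2⟩
  obtain ⟨j, x, x', rfl, rfl⟩ := h
  have := le_of_atLeaf_eq_rightEnd h2
  have := le_of_atLeaf_eq_rightEnd h1.symm
  omega

/-- Splitting a leaf off the spine preserves the left-to-right order of points in different leaves,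
whereas a letter `C` can reverse it. -/
theorem LeadLT.caretLetter {z z' : Square} (h : LeadLT z z') (c : Caret) (k : ℕ) :
    LeadLT ((caretLetter c k).val z) ((caretLetter c k).val z') := by
  obtain ⟨j, x, x', rfl, rfl⟩ := h
  rcases lt_trichotomy j k with hj | rfl | hj
  · obtain ⟨d, rfl⟩ := Nat.exists_eq_add_of_lt hj
    rw [caretLetter_atLeaf_of_lt c hj, Nat.add_right_comm, caretLetter_rightEnd_le]
    exact ⟨_, _, _, rfl, rfl⟩
  · rw [caretLetter_rightEnd_of_lt c (Nat.lt_succ_self j)]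
    obtain ⟨e, y, rfl⟩ := join_cases c x
    cases e
    · rw [caretLetter_atLeaf_false, rightEnd_succ']
      exact ⟨_, _, _, rfl, rfl⟩
    · rw [caretLetter_atLeaf_true]
      exact ⟨_, _, _, rfl, rfl⟩
  · rw [atLeaf, caretLetter_rightEnd_of_lt c hj, ← atLeaf,
      caretLetter_rightEnd_of_lt c (by omega)]
    exact ⟨_, _, _, rfl, rfl⟩

theorem LeadLT.eval {k : ℕ} {w : List Letter} (hw : IsCaretWord k w) {z z' : Square}
    (h : LeadLT z z') : LeadLT (eval w z) (eval w z') := by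
  induction w generalizing z z' with
  | nil => exact h
  | cons x w ih =>
    obtain ⟨c, j, -, rfl⟩ := hw x (by simp)
    exact ih (fun y hy => hw y (by simp [hy])) (h.caretLetter c j)

/-- Far out on the right end, the first word removes exactly s leading ones from the second
coordinate of a suitable point and the second word removes s'. If s < s', a nonempty prefix of ones
would fix every stream. -/
theorem le_of_eval_wordC_append_eq {i s i' s' : ℕ} {u u' : List Letter} (hu : IsCaretWord 0 u)
    (hu' : IsCaretWord 0 u') (h : eval (wordC i s ++ u) = eval (wordC i' s' ++ u')) :
    s' ≤ s := by
  by_contra hlt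
  obtain ⟨d, rfl⟩ := Nat.exists_eq_add_of_lt (not_le.1 hlt)
  obtain ⟨K₁, h₁⟩ := hu.exists_eval_rightEnd
  obtain ⟨K₂, h₂⟩ := hu'.exists_eval_rightEnd
  obtain ⟨K, hK₁, hK₂, hK₃, hK₄⟩ : ∃ K, K₁ ≤ K ∧ K₂ ≤ K ∧ i ≤ K ∧ i' ≤ K :=
    ⟨K₁ + K₂ + i + i', by omega, by omega, by omega, by omega⟩
  have snd_rightEnd : ∀ k z, (rightEnd k z).2 = z.2 := fun k z => by
    induction k with
    | zero => rfl
    | succ k ih => exact ih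
  have key : List.replicate (d + 1) true = [] := eq_nil_of_forall_append_eq fun y => by
    have hz := Equiv.congr_fun h
      (rightEnd K (Rect.place ([], List.replicate (s + d + 1) true) (y, y)))
    rw [eval_append_apply, eval_append_apply, eval_wordC_corner hK₄, h₂ _ (by omega),
      Nat.add_assoc s, List.replicate_add] at hz
    have e : Rect.place ([], List.replicate s true ++ List.replicate (d + 1) true) (y, y) =
      Rect.place ([], List.replicate s true) (Rect.place ([], List.replicate (d + 1) true) (y, y)) :=
      place_append ([], List.replicate s true) [] (List.replicate (d + 1) true) (y, y)
    rw [e, eval_wordC_corner hK₃, h₁ _ (by omega)] at hz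
    have := congrArg Prod.snd hz
    rwa [snd_rightEnd, snd_rightEnd] at this
  simp at key

/-- Two test points in different horizontal halves: z in leaf i, z' to its right. The letter `C i`
cuts horizontally first and puts z' before z, while letters `C` with larger indices keep z before
z'. The first word must contain a letter `C`, hence s + 1. -/
theorem not_lt_of_eval_wordC_append_eq {i s i' s' : ℕ} {u u' : List Letter}
    (hu : IsCaretWord 0 u) (hu' : IsCaretWord 0 u')
    (h : eval (wordC i (s + 1) ++ u) = eval (wordC i' s' ++ u')) : ¬ i < i' := by
  intro hlt
  let x : Square := (Stream'.const false, Stream'.const false)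
  let z : Square := atLeaf i (join .horiz true x)
  let z' : Square := rightEnd (i + 1) (join .horiz false x)
  have h1 : LeadLT (eval (wordC i (s + 1) ++ u) z') (eval (wordC i (s + 1) ++ u) z) := by
    rw [eval_append_apply, eval_append_apply]
    refine LeadLT.eval hu ?_
    have hz : z = rightEnd i (join .horiz true (join .vert false x)) := rfl
    have hz' : z' = rightEnd i (join .horiz false (join .vert true x)) := rightEnd_succ' _ _
    rw [wordC_succ, eval_cons_apply, eval_cons_apply, hz, hz', C_rightEnd_false, C_rightEnd_true,
      eval_wordC_atLeaf (Nat.lt_succ_self i)]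
    obtain ⟨y, hy⟩ := exists_eval_wordC_rightEnd (le_refl (i + 1)) s (join .vert false x)
    exact ⟨_, _, _, rfl, hy⟩
  have h2 : LeadLT (eval (wordC i' s' ++ u') z) (eval (wordC i' s' ++ u') z') := by
    rw [eval_append_apply, eval_append_apply]
    refine LeadLT.eval hu' ?_
    obtain ⟨y, hy⟩ := exists_eval_wordC_rightEnd (show i + 1 ≤ i' from hlt) s' (join .horiz false x)
    exact ⟨i, _, y, eval_wordC_atLeaf hlt s' _, hy⟩
  rw [h] at h1
  exact h1.asymm h2

/-- The conclusion concerns words because the start index of an empty word is not determined. -/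
theorem wordC_eq_of_eval_append_eq {i s i' s' : ℕ} {u u' : List Letter} (hu : IsCaretWord 0 u)
    (hu' : IsCaretWord 0 u') (h : eval (wordC i s ++ u) = eval (wordC i' s' ++ u')) :
    wordC i s = wordC i' s' := by
  obtain rfl : s = s' := le_antisymm (le_of_eval_wordC_append_eq hu' hu h.symm)
    (le_of_eval_wordC_append_eq hu hu' h)
  cases s with
  | zero => rfl
  | succ s =>
    have := not_lt_of_eval_wordC_append_eq hu hu' h
    have := not_lt_of_eval_wordC_append_eq hu' hu h.symm
    rw [show i = i' by omega]

theorem gridWord_injective {n m i s i' s' : ℕ} {a b c a' b' c' : ℕ → ℕ}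
    (h : eval (gridWord n m i s a b c) = eval (gridWord n m i' s' a' b' c')) :
    gridWord n m i s a b c = gridWord n m i' s' a' b' c' := by
  obtain ⟨α, β, hw⟩ := gridWord_eq_caretWord n m i s a b c
  obtain ⟨α', β', hw'⟩ := gridWord_eq_caretWord n m i' s' a' b' c'
  rw [hw, hw'] at h ⊢
  have hC := wordC_eq_of_eval_append_eq (isCaretWord_caretWord le_rfl _ α β)
    (isCaretWord_caretWord le_rfl _ α' β') h
  rw [hC] at h ⊢
  rw [caretWord_congr (caretWord_injective (eval_append_left_cancel h))]

/-! ### Dyadic subdivisions are given by trees -/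

theorem join_eq_place_iff (c : Caret) (e e' : Bool) (r : Rect) (z : Square) :
    join c e z ∈ Set.range (Rect.place (c.child e' r)) ↔ e = e' ∧ z ∈ Set.range (Rect.place r) := by
  simp only [Set.mem_range, place_child]
  constructor
  · rintro ⟨y, hy⟩
    have := join_inj hy
    exact ⟨this.1.symm, y, this.2⟩
  · rintro ⟨rfl, y, rfl⟩
    exact ⟨y, rfl⟩

open Classical in
/-- The number of rectangles in the list that contain the point. -/
noncomputable def coverCount (L : List Rect) (z : Square) : ℕ :=
  L.countP fun r => z ∈ Set.range (Rect.place r)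

theorem coverCount_map_child_self (c : Caret) (e : Bool) (L : List Rect) (z : Square) :
    coverCount (L.map (c.child e)) (join c e z) = coverCount L z := by
  simp only [coverCount, List.countP_map]
  congr 1
  ext r
  exact decide_eq_decide.2 ((join_eq_place_iff c e e r z).trans (and_iff_right rfl))

theorem coverCount_map_child_of_ne (c : Caret) {e e' : Bool} (he : e ≠ e') (L : List Rect)
    (z : Square) : coverCount (L.map (c.child e')) (join c e z) = 0 := by
  simp only [coverCount, List.countP_eq_zero, List.mem_map]
  rintro _ ⟨r, -, rfl⟩
  simp [join_eq_place_iff, he, -Set.mem_range]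

theorem coverCount_append (L L' : List Rect) (z : Square) :
    coverCount (L ++ L') z = coverCount L z + coverCount L' z := by
  simp [coverCount, List.countP_append]

theorem coverCount_perm {L L' : List Rect} (h : L.Perm L') (z : Square) :
    coverCount L z = coverCount L' z := h.countP_eq _

theorem coverCount_leafRects (T : BinaryTree Caret) (z : Square) :
    coverCount (leafRects T) z = 1 := by
  induction T generalizing z with
  | nil => simp [leafRects, coverCount, place_nil]
  | node c l r ihl ihr =>
    obtain ⟨e, x, rfl⟩ := join_cases c z
    rw [leafRects, coverCount_append]
    cases e
    · rw [coverCount_map_child_self, coverCount_map_child_of_ne c (by simp), ihl]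
    · rw [coverCount_map_child_self, coverCount_map_child_of_ne c (by simp), ihr]

theorem exists_perm_children (c : Caret) (L : List Rect) (h : ∀ r ∈ L, ∃ e q, r = c.child e q) :
    ∃ L₀ L₁ : List Rect, L.Perm (L₀.map (c.child false) ++ L₁.map (c.child true)) := by
  induction L with
  | nil => exact ⟨[], [], .refl _⟩
  | cons r L ih =>
    obtain ⟨L₀, L₁, hL⟩ := ih fun q hq => h q (by simp [hq])
    obtain ⟨e, q, rfl⟩ := h r (by simp)
    cases e
    · exact ⟨q :: L₀, L₁, hL.cons _⟩
    · exact ⟨L₀, q :: L₁, (hL.cons _).trans List.perm_middle.symm⟩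

/-- If neither cut through the middle is respected, one rectangle has full width and another full
height. They cross, so they are the same entry, which is then the whole square. -/
theorem exists_common_caret {L : List Rect} (h : ∀ z, coverCount L z = 1) :
    L = [([], [])] ∨ ∃ c : Caret, ∀ r ∈ L, ∃ e q, r = c.child e q := by
  classical
  by_cases h₁ : ∀ r ∈ L, r.1 ≠ []
  · refine .inr ⟨.vert, fun r hr => ?_⟩
    obtain ⟨e, q, hq⟩ := List.exists_cons_of_ne_nil (h₁ r hr)
    exact ⟨e, (q, r.2), Prod.ext hq rfl⟩
  by_cases h₂ : ∀ r ∈ L, r.2 ≠ []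
  · refine .inr ⟨.horiz, fun r hr => ?_⟩
    obtain ⟨e, q, hq⟩ := List.exists_cons_of_ne_nil (h₂ r hr)
    exact ⟨e, (r.1, q), Prod.ext rfl hq⟩
  push Not at h₁ h₂
  obtain ⟨⟨u, v⟩, hr, rfl⟩ := h₁
  obtain ⟨⟨u', v'⟩, hr', rfl⟩ := h₂
  left
  -- Erasing one entry, instead of comparing rectangles, also rules out repetitions.
  have hp := List.perm_cons_erase hr
  let z : Square := Rect.place (u', v) (Stream'.const false, Stream'.const false)
  have hz : z ∈ Set.range (Rect.place ([], v)) :=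
    ⟨(Stream'.appendStream' u' (Stream'.const false), Stream'.const false), rfl⟩
  have hz' : z ∈ Set.range (Rect.place (u', [])) :=
    ⟨(Stream'.const false, Stream'.appendStream' v (Stream'.const false)), rfl⟩
  have h0 : ∀ y ∈ Set.range (Rect.place ([], v)), ∀ q ∈ L.erase ([], v),
      y ∉ Set.range (Rect.place q) := by
    intro y hy q hq hyq
    have h1 := coverCount_perm hp y
    rw [h y, coverCount, List.countP_cons_of_pos (by simpa using hy)] at h1
    have h2 := List.countP_eq_zero.1 (Nat.succ.inj h1.symm) q hq
    exact h2 (by simpa using hyq)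
  have hq : (u', []) ∉ L.erase ([], v) := fun hq => h0 z hz _ hq hz'
  have he : ((u', []) : Rect) = ([], v) := by
    by_contra hne
    exact hq ((List.mem_erase_of_ne hne).2 hr')
  obtain ⟨rfl, rfl⟩ := Prod.mk.inj he
  have hn : L.erase ([], []) = [] := List.eq_nil_iff_forall_not_mem.2 fun q hq =>
    h0 _ ⟨Rect.place q z, rfl⟩ q hq ⟨z, rfl⟩
  rw [hn] at hp
  exact List.perm_singleton.1 hp

theorem exists_tree_of_coverCount {L : List Rect} (h : ∀ z, coverCount L z = 1) :
    ∃ S : BinaryTree Caret, L.Perm (leafRects S) := by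
  obtain ⟨N, hN⟩ : ∃ N : ℕ, ∀ r ∈ L, r.1.length + r.2.length ≤ N := by
    refine ⟨(L.map fun r => r.1.length + r.2.length).sum, fun r hr => ?_⟩
    exact List.single_le_sum (by simp) _ (List.mem_map_of_mem hr)
  induction N generalizing L with
  | zero =>
    rcases exists_common_caret h with rfl | ⟨c, hc⟩
    · exact ⟨.nil, .refl _⟩
    · have hL : L = [] := List.eq_nil_iff_forall_not_mem.2 fun r hr => by
        obtain ⟨e, q, rfl⟩ := hc r hr
        have := hN _ hr
        cases c <;> simp [Caret.child] at this
      have := h (Stream'.const false, Stream'.const false)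
      simp [hL, coverCount] at this
  | succ N ih =>
    rcases exists_common_caret h with rfl | ⟨c, hc⟩
    · exact ⟨.nil, .refl _⟩
    · obtain ⟨L₀, L₁, hp⟩ := exists_perm_children c L hc
      have length_child : ∀ e q, (c.child e q).1.length + (c.child e q).2.length =
          q.1.length + q.2.length + 1 := fun e q => by
        cases c <;> simp [Caret.child] <;> omega
      have hp' := fun z => (coverCount_perm hp z).symm.trans (h z)
      obtain ⟨S₀, hS₀⟩ := ih (L := L₀)
        (fun z => by
          have := hp' (join c false z)
          rwa [coverCount_append, coverCount_map_child_self,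
            coverCount_map_child_of_ne c (by simp)] at this)
        (fun q hq => by
          have := hN (c.child false q)
            (hp.mem_iff.2 (List.mem_append_left _ (List.mem_map_of_mem hq)))
          rw [length_child] at this
          omega)
      obtain ⟨S₁, hS₁⟩ := ih (L := L₁)
        (fun z => by
          have := hp' (join c true z)
          rwa [coverCount_append, coverCount_map_child_self,
            coverCount_map_child_of_ne c (by simp), Nat.zero_add] at this)
        (fun q hq => by
          have := hN (c.child true q)
            (hp.mem_iff.2 (List.mem_append_right _ (List.mem_map_of_mem hq)))
          rw [length_child] at this
          omega)
      exact ⟨.node c S₀ S₁, hp.trans ((hS₀.map _).append (hS₁.map _))⟩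

theorem MapsRect.mem_range_iff {f : Equiv.Perm Square} {r r' : Rect} (h : MapsRect f r r')
    (z : Square) : f z ∈ Set.range (Rect.place r') ↔ z ∈ Set.range (Rect.place r) := by
  constructor
  · rintro ⟨y, hy⟩
    exact ⟨y, f.injective ((h y).trans hy)⟩
  · rintro ⟨y, rfl⟩
    exact ⟨y, (h y).symm⟩

theorem coverCount_image {f : Equiv.Perm Square} {L L' : List Rect}
    (h : List.Forall₂ (MapsRect f) L L') (z : Square) :
    coverCount L' (f z) = coverCount L z := by
  induction h with
  | nil => rfl
  | cons h _ ih =>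
    rw [coverCount, coverCount, List.countP_cons, List.countP_cons]
    exact congrArg₂ (· + ·) ih (congrArg (fun b : Bool => if b then 1 else 0)
      (decide_eq_decide.2 (h.mem_range_iff z)))

/-! ### Grids on which a map is affine -/

theorem MapsRect.unique {f : Equiv.Perm Square} {r r₁ r₂ : Rect} (h₁ : MapsRect f r r₁)
    (h₂ : MapsRect f r r₂) : r₁ = r₂ :=
  place_injective_rect fun z => (h₁ z).symm.trans (h₂ z)

/-- `f` maps the basic dyadic rectangle affinely onto a basic dyadic rectangle. -/
def IsAffineOn (f : Equiv.Perm Square) (r : Rect) : Prop := ∃ r' : Rect, MapsRect f r r'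

theorem IsAffineOn.append {f : Equiv.Perm Square} {I J : List Bool} (h : IsAffineOn f (I, J))
    (u v : List Bool) : IsAffineOn f (I ++ u, J ++ v) := by
  obtain ⟨r', hr'⟩ := h
  exact ⟨(r'.1 ++ u, r'.2 ++ v), fun z =>
    by rw [place_append r' u v, ← hr']; exact congrArg f (place_append (I, J) u v z)⟩

/-- Affinity on the halves alone is not enough, since their images need not be adjacent. The strip
`(I, J ++ v)` meets both halves and forces their images to be the two halves of one rectangle. -/
theorem isAffineOn_of_vertical_halves {f : Equiv.Perm Square} {I J v : List Bool}
    (h₀ : IsAffineOn f (I ++ [false], J)) (h₁ : IsAffineOn f (I ++ [true], J))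
    (hv : IsAffineOn f (I, J ++ v)) : IsAffineOn f (I, J) := by
  obtain ⟨⟨R₀, S₀⟩, h₀⟩ := h₀
  obtain ⟨⟨R₁, S₁⟩, h₁⟩ := h₁
  obtain ⟨⟨P, Q⟩, hv⟩ := hv
  -- Compares the two descriptions of the image of `(I ++ [e], J ++ v)`, from the half and from the
  -- strip.
  have key : ∀ (e : Bool) (R S : List Bool), MapsRect f (I ++ [e], J) (R, S) →
      (R, S ++ v) = (P ++ [e], Q) := fun e R S h => by
    have h' : MapsRect f (I ++ [e], J ++ v) (R, S ++ v) := fun z => by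
      have e1 := place_append (I ++ [e], J) [] v z
      have e2 := place_append (R, S) [] v z
      simp only [List.append_nil] at e1 e2
      rw [e1, e2, h]
    have h'' : MapsRect f (I ++ [e], J ++ v) (P ++ [e], Q) := fun z => by
      have e1 := place_append (I, J ++ v) [e] [] z
      have e2 := place_append (P, Q) [e] [] z
      simp only [List.append_nil] at e1 e2
      rw [e1, e2, hv]
    exact h'.unique h''
  obtain ⟨hR₀, hS₀⟩ := Prod.mk.inj (key _ _ _ h₀)
  obtain ⟨hR₁, hS₁⟩ := Prod.mk.inj (key _ _ _ h₁)
  have hS : S₀ = S₁ := List.append_cancel_right (hS₀.trans hS₁.symm)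
  subst hS hR₀ hR₁
  refine ⟨(P, S₀), fun z => ?_⟩
  obtain ⟨e, x, rfl⟩ := join_cases .vert z
  have e1 : ∀ K L : List Bool, Rect.place (K, L) (join .vert e x) = Rect.place (K ++ [e], L) x :=
    fun K L => by
      have := place_append (K, L) [e] [] x
      simp only [List.append_nil] at this
      exact this.symm
  rw [e1, e1]
  cases e
  · exact h₀ x
  · exact h₁ x

theorem isAffineOn_of_horizontal_halves {f : Equiv.Perm Square} {I J u : List Bool}
    (h₀ : IsAffineOn f (I, J ++ [false])) (h₁ : IsAffineOn f (I, J ++ [true]))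
    (hu : IsAffineOn f (I ++ u, J)) : IsAffineOn f (I, J) := by
  -- Conjugation by the exchange of coordinates reduces this to vertical halves.
  let sw : Equiv.Perm Square := Equiv.prodComm _ _
  have swap : ∀ {K L : List Bool} {g : Equiv.Perm Square}, IsAffineOn g (K, L) →
      IsAffineOn ((sw.trans g).trans sw) (L, K) := fun {K L g} ⟨r', h⟩ =>
    ⟨(r'.2, r'.1), fun z => congrArg sw (h (z.2, z.1))⟩
  have := isAffineOn_of_vertical_halves (swap h₀) (swap h₁) (swap hu)
  have h := swap this
  rwa [show (sw.trans ((sw.trans f).trans sw)).trans sw = f from rfl] at h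

/-- `f` is affine on all rectangles of the grid. -/
def IsGridFor (f : Equiv.Perm Square) (Tv Th : BinaryTree Unit) : Prop :=
  ∀ I ∈ leafIntervals Tv, ∀ J ∈ leafIntervals Th, IsAffineOn f (I, J)

theorem leafRects_paint_horiz (T : BinaryTree Unit) :
    leafRects (paint .horiz T) = (leafIntervals T).map fun J => ([], J) := by
  induction T with
  | nil => rfl
  | node v l r ihl ihr =>
    have e : leafRects (paint .horiz (.node v l r)) =
      (leafRects (paint .horiz l)).map (Caret.horiz.child false) ++
      (leafRects (paint .horiz r)).map (Caret.horiz.child true) := rfl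
    rw [e, ihl, ihr, leafIntervals]
    simp [Function.comp_def, Caret.child]

theorem leafRects_gridTree (Tv Th : BinaryTree Unit) :
    leafRects (gridTree Tv Th) =
      (leafIntervals Tv).flatMap fun I => (leafIntervals Th).map fun J => (I, J) := by
  induction Tv with
  | nil => exact (leafRects_paint_horiz Th).trans (by simp [leafIntervals])
  | node v l r ihl ihr =>
    have e : leafRects (gridTree (.node v l r) Th) =
      (leafRects (gridTree l Th)).map (Caret.vert.child false) ++
      (leafRects (gridTree r Th)).map (Caret.vert.child true) := rfl
    rw [e, ihl, ihr, leafIntervals]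
    simp [List.map_flatMap, List.flatMap_map, Function.comp_def, Caret.child]

theorem mem_leafRects_gridTree (Tv Th : BinaryTree Unit) (r : Rect) :
    r ∈ leafRects (gridTree Tv Th) ↔ r.1 ∈ leafIntervals Tv ∧ r.2 ∈ leafIntervals Th := by
  obtain ⟨I, J⟩ := r
  simp [leafRects_gridTree]

theorem GridDiagram.Represents.isGridFor {D : GridDiagram} {f : Equiv.Perm Square}
    (h : D.Represents f) : IsGridFor f D.Tv D.Th := by
  intro I hI J hJ
  have : ∀ {L L' : List Rect}, List.Forall₂ (MapsRect f) L L' → ∀ r ∈ L, IsAffineOn f r := by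
    intro L L' h
    induction h with
    | nil => simp
    | cons h _ ih => exact List.forall_mem_cons.2 ⟨⟨_, h⟩, ih⟩
  exact this h (I, J) ((mem_leafRects_gridTree _ _ _).2 ⟨hI, hJ⟩)

theorem GridDiagram.ext_of_represents {D D' : GridDiagram} {f : Equiv.Perm Square}
    (h : D.Represents f) (h' : D'.Represents f) (hv : D.Tv = D'.Tv) (hh : D.Th = D'.Th) :
    D = D' := by
  obtain ⟨Tv, Th, t, _, _⟩ := D
  obtain ⟨Tv', Th', t', _, _⟩ := D'
  obtain rfl : Tv = Tv' := hv
  obtain rfl : Th = Th' := hh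
  have : ∀ {L L₁ L₂ : List Rect}, List.Forall₂ (MapsRect f) L L₁ →
      List.Forall₂ (MapsRect f) L L₂ → L₁ = L₂ := by
    intro L L₁ L₂ h₁
    induction h₁ generalizing L₂ with
    | nil => intro h₂; cases h₂; rfl
    | cons h _ ih =>
      intro h₂
      cases h₂ with
      | cons h' h₂ => rw [h.unique h', ih h₂]
  obtain rfl : t = t' := this h h'
  rfl

theorem IsGridFor.exists_diagram {f : Equiv.Perm Square} {Tv Th : BinaryTree Unit}
    (h : IsGridFor f Tv Th) : ∃ D : GridDiagram, D.Represents f ∧ D.Tv = Tv ∧ D.Th = Th := by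
  have h' : ∀ r ∈ leafRects (gridTree Tv Th), ∃ r', MapsRect f r r' := fun r hr =>
    h _ ((mem_leafRects_gridTree _ _ _).1 hr).1 _ ((mem_leafRects_gridTree _ _ _).1 hr).2
  choose! g hg using h'
  have hF : List.Forall₂ (MapsRect f) (leafRects (gridTree Tv Th))
      ((leafRects (gridTree Tv Th)).map g) := by
    rw [List.forall₂_map_right_iff, List.forall₂_same]
    exact hg
  exact ⟨⟨Tv, Th, _, List.length_map _, exists_tree_of_coverCount fun z => by
    rw [← f.apply_symm_apply z, coverCount_image hF, coverCount_leafRects]⟩, hF, rfl, rfl⟩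

/-! ### Existence of a reduced diagram -/

/-- The complete tree of depth `N`. -/
def completeTree : ℕ → BinaryTree Unit
  | 0 => .nil
  | N + 1 => .node () (completeTree N) (completeTree N)

theorem length_of_mem_leafIntervals_completeTree {N : ℕ} {u : List Bool}
    (h : u ∈ leafIntervals (completeTree N)) : u.length = N := by
  induction N generalizing u with
  | zero => simp_all [completeTree, leafIntervals]
  | succ N ih =>
    simp only [completeTree, leafIntervals, List.mem_append, List.mem_map] at h
    rcases h with ⟨v, hv, rfl⟩ | ⟨v, hv, rfl⟩ <;> simp [ih hv]

theorem IsDyadic.exists_isGridFor {f : Equiv.Perm Square} (h : IsDyadic f) :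
    ∃ Tv Th, IsGridFor f Tv Th := by
  obtain ⟨s, hs, hm⟩ := h
  let N : ℕ := s.sup fun r => max r.1.length r.2.length
  refine ⟨completeTree N, completeTree N, fun I hI J hJ => ?_⟩
  -- Any point of the cell will do: the prefixes of `q` have length at most N, so a rectangle `q`
  -- meeting the cell contains it.
  obtain ⟨q, hq, y, hy⟩ := hs (Rect.place (I, J) (Stream'.const false, Stream'.const false))
  have hN : max q.1.length q.2.length ≤ N :=
    Finset.le_sup (f := fun r : Rect => max r.1.length r.2.length) hq
  have hI' := length_of_mem_leafIntervals_completeTree hI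
  have hJ' := length_of_mem_leafIntervals_completeTree hJ
  obtain ⟨u, rfl⟩ := exists_append_of_stream (congrArg Prod.fst hy)
    (show q.1.length ≤ I.length by omega)
  obtain ⟨v, rfl⟩ := exists_append_of_stream (congrArg Prod.snd hy)
    (show q.2.length ≤ J.length by omega)
  exact IsAffineOn.append (hm q hq) u v

theorem exists_erase_caret {T : BinaryTree Unit} {I : List Bool}
    (h₀ : I ++ [false] ∈ leafIntervals T) (h₁ : I ++ [true] ∈ leafIntervals T) :
    ∃ T' : BinaryTree Unit, T'.numNodes < T.numNodes ∧
      ∀ K ∈ leafIntervals T', K = I ∨ K ∈ leafIntervals T := by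
  induction T generalizing I with
  | nil => simp [leafIntervals] at h₀
  | node v l r ihl ihr =>
    cases I with
    | nil => exact ⟨.nil, by simp, by simp [leafIntervals]⟩
    | cons e I =>
      cases e
      · simp only [leafIntervals, List.mem_append, List.mem_map, List.cons_append, List.cons.injEq,
          true_and, exists_eq_right, Bool.true_eq_false, false_and, and_false, exists_false,
          or_false] at h₀ h₁
        obtain ⟨T', hn, hT'⟩ := ihl h₀ h₁
        refine ⟨.node v T' r, by simpa using hn, fun K hK => ?_⟩
        simp only [leafIntervals, List.mem_append, List.mem_map] at hK ⊢
        rcases hK with ⟨K, hK, rfl⟩ | hK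
        · rcases hT' K hK with rfl | hK
          · exact .inl rfl
          · exact .inr (.inl ⟨K, hK, rfl⟩)
        · exact .inr (.inr hK)
      · simp only [leafIntervals, List.mem_append, List.mem_map, List.cons_append, List.cons.injEq,
          true_and, exists_eq_right, Bool.false_eq_true, false_and, and_false, exists_false,
          false_or] at h₀ h₁
        obtain ⟨T', hn, hT'⟩ := ihr h₀ h₁
        refine ⟨.node v l T', by simpa using hn, fun K hK => ?_⟩
        simp only [leafIntervals, List.mem_append, List.mem_map] at hK ⊢
        rcases hK with hK | ⟨K, hK, rfl⟩
        · exact .inr (.inl hK)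
        · rcases hT' K hK with rfl | hK
          · exact .inl rfl
          · exact .inr (.inr ⟨K, hK, rfl⟩)

theorem IsDyadic.exists_isReducedFor {f : Equiv.Perm Square} (h : IsDyadic f) :
    ∃ D : GridDiagram, D.IsReducedFor f := by
  -- A grid with the least total number of carets is reduced, since an erasable caret would give a
  -- smaller one.
  have hne : ∃ N Tv Th, IsGridFor f Tv Th ∧ Tv.numNodes + Th.numNodes = N := by
    obtain ⟨Tv, Th, hg⟩ := h.exists_isGridFor
    exact ⟨_, Tv, Th, hg, rfl⟩
  classical
  obtain ⟨Tv, Th, hg, hN⟩ := Nat.find_spec hne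
  have hmin : ∀ Tv' Th', IsGridFor f Tv' Th' →
      Tv.numNodes + Th.numNodes ≤ Tv'.numNodes + Th'.numNodes := fun Tv' Th' hg' =>
    hN.le.trans (Nat.find_min' hne ⟨Tv', Th', hg', rfl⟩)
  obtain ⟨D, hD, rfl, rfl⟩ := hg.exists_diagram
  refine ⟨D, hD, fun I h₀ h₁ => ?_, fun J h₀ h₁ => ?_⟩
  · by_contra! hc
    obtain ⟨T', hn, hT'⟩ := exists_erase_caret h₀ h₁
    have := hmin T' D.Th fun K hK J hJ => by
      rcases hT' K hK with rfl | hK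
      · exact hc J hJ
      · exact hg K hK J hJ
    omega
  · by_contra! hc
    obtain ⟨T', hn, hT'⟩ := exists_erase_caret h₀ h₁
    have := hmin D.Tv T' fun I hI K hK => by
      rcases hT' K hK with rfl | hK
      · exact hc I hI
      · exact hg I hI K hK
    omega

/-! ### Uniqueness of the reduced diagram -/

theorem exists_prefix_or_exposed_caret (T : BinaryTree Unit) (u : List Bool) :
    (∃ I ∈ leafIntervals T, I <+: u) ∨
      ∃ v, u ++ v ++ [false] ∈ leafIntervals T ∧ u ++ v ++ [true] ∈ leafIntervals T := by
  induction T generalizing u with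
  | nil => exact .inl ⟨[], by simp [leafIntervals], List.nil_prefix⟩
  | node c l r ihl ihr =>
    simp only [leafIntervals, List.mem_append, List.mem_map]
    cases u with
    | nil =>
      -- The root is interior, and descending from it ends at a caret with two leaves.
      right
      rcases ihl [] with ⟨I, hI, hp⟩ | ⟨v, h₀, h₁⟩
      · rcases ihr [] with ⟨I', hI', hp'⟩ | ⟨v, h₀, h₁⟩
        · obtain rfl := List.prefix_nil.1 hp
          obtain rfl := List.prefix_nil.1 hp'
          exact ⟨[], .inl ⟨[], hI, rfl⟩, .inr ⟨[], hI', rfl⟩⟩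
        · exact ⟨true :: v, .inr ⟨_, h₀, rfl⟩, .inr ⟨_, h₁, rfl⟩⟩
      · exact ⟨false :: v, .inl ⟨_, h₀, rfl⟩, .inl ⟨_, h₁, rfl⟩⟩
    | cons e u =>
      cases e
      · rcases ihl u with ⟨I, hI, hp⟩ | ⟨v, h₀, h₁⟩
        · exact .inl ⟨false :: I, .inl ⟨I, hI, rfl⟩, (List.prefix_cons_inj _).2 hp⟩
        · exact .inr ⟨v, .inl ⟨_, h₀, rfl⟩, .inl ⟨_, h₁, rfl⟩⟩
      · rcases ihr u with ⟨I, hI, hp⟩ | ⟨v, h₀, h₁⟩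
        · exact .inl ⟨true :: I, .inr ⟨I, hI, rfl⟩, (List.prefix_cons_inj _).2 hp⟩
        · exact .inr ⟨v, .inr ⟨_, h₀, rfl⟩, .inr ⟨_, h₁, rfl⟩⟩

/-- Every leaf interval of `T'` lies in a leaf interval of `T`. -/
def Refines (T' T : BinaryTree Unit) : Prop :=
  ∀ I' ∈ leafIntervals T', ∃ I ∈ leafIntervals T, I <+: I'

theorem Refines.left {v v' : Unit} {l r l' r' : BinaryTree Unit}
    (h : Refines (.node v l r) (.node v' l' r')) : Refines l l' := by
  intro I hI
  obtain ⟨K, hK, hp⟩ := h (false :: I) (by simp [leafIntervals, hI])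
  simp only [leafIntervals, List.mem_append, List.mem_map] at hK
  rcases hK with ⟨K, hK, rfl⟩ | ⟨K, hK, rfl⟩
  · exact ⟨K, hK, (List.prefix_cons_inj _).1 hp⟩
  · simp at hp

theorem Refines.right {v v' : Unit} {l r l' r' : BinaryTree Unit}
    (h : Refines (.node v l r) (.node v' l' r')) : Refines r r' := by
  intro I hI
  obtain ⟨K, hK, hp⟩ := h (true :: I) (by simp [leafIntervals, hI])
  simp only [leafIntervals, List.mem_append, List.mem_map] at hK
  rcases hK with ⟨K, hK, rfl⟩ | ⟨K, hK, rfl⟩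
  · simp at hp
  · exact ⟨K, hK, (List.prefix_cons_inj _).1 hp⟩

theorem not_refines_nil_node (v : Unit) (l r : BinaryTree Unit) :
    ¬ Refines .nil (.node v l r) := by
  intro h
  obtain ⟨K, hK, hp⟩ := h [] (by simp [leafIntervals])
  obtain rfl := List.prefix_nil.1 hp
  simp [leafIntervals] at hK

theorem Refines.antisymm {T T' : BinaryTree Unit} (h : Refines T T') (h' : Refines T' T) :
    T = T' := by
  induction T generalizing T' with
  | nil =>
    cases T' with
    | nil => rfl
    | node v l r => exact (not_refines_nil_node v l r h).elim
  | node v l r ihl ihr =>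
    cases T' with
    | nil => exact (not_refines_nil_node v l r h').elim
    | node v' l' r' => rw [ihl h.left h'.left, ihr h.right h'.right]

/-- Otherwise `D.Tv` has an exposed caret inside a leaf interval of `Tv`, and the other grid shows
that this caret could be erased. -/
theorem GridDiagram.IsReducedFor.refines_Tv {D : GridDiagram} {f : Equiv.Perm Square}
    (h : D.IsReducedFor f) {Tv Th : BinaryTree Unit} (hg : IsGridFor f Tv Th) :
    Refines Tv D.Tv := by
  intro I' hI'
  rcases exists_prefix_or_exposed_caret D.Tv I' with hp | ⟨v, h₀, h₁⟩
  · exact hp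
  obtain ⟨J, hJ, hn⟩ := h.2.1 (I' ++ v) h₀ h₁
  refine (hn ?_).elim
  -- Either J lies in a leaf interval of `Th` and affinity restricts, or J contains one, which
  -- provides the strip across both halves.
  rcases exists_prefix_or_exposed_caret Th J with ⟨J', hJ', w, rfl⟩ | ⟨w, hw, -⟩
  · exact (hg I' hI' J' hJ').append v w
  · refine isAffineOn_of_vertical_halves (h.1.isGridFor _ h₀ J hJ) (h.1.isGridFor _ h₁ J hJ)
      (v := w ++ [false]) ?_
    have := (hg I' hI' _ hw).append v []
    rwa [List.append_nil, List.append_assoc] at this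

theorem GridDiagram.IsReducedFor.refines_Th {D : GridDiagram} {f : Equiv.Perm Square}
    (h : D.IsReducedFor f) {Tv Th : BinaryTree Unit} (hg : IsGridFor f Tv Th) :
    Refines Th D.Th := by
  intro J' hJ'
  rcases exists_prefix_or_exposed_caret D.Th J' with hp | ⟨v, h₀, h₁⟩
  · exact hp
  obtain ⟨I, hI, hn⟩ := h.2.2 (J' ++ v) h₀ h₁
  refine (hn ?_).elim
  rcases exists_prefix_or_exposed_caret Tv I with ⟨I', hI', w, rfl⟩ | ⟨w, hw, -⟩
  · exact (hg I' hI' J' hJ').append w v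
  · refine isAffineOn_of_horizontal_halves (h.1.isGridFor I hI _ h₀) (h.1.isGridFor I hI _ h₁)
      (u := w ++ [false]) ?_
    have := (hg _ hw J' hJ').append [] v
    rwa [List.append_nil, List.append_assoc] at this

theorem GridDiagram.IsReducedFor.unique {D D' : GridDiagram} {f : Equiv.Perm Square}
    (h : D.IsReducedFor f) (h' : D'.IsReducedFor f) : D = D' :=
  GridDiagram.ext_of_represents h.1 h'.1
    ((h'.refines_Tv h.1.isGridFor).antisymm (h.refines_Tv h'.1.isGridFor))
    ((h'.refines_Th h.1.isGridFor).antisymm (h.refines_Th h'.1.isGridFor))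

/-! ### Permutation words -/

theorem ofPerm_spot (k : ℕ) (σ : Equiv.Perm (Fin (k + 1))) (p : Fin (k + 1)) (z : Square) :
    ofPerm k σ (spot k p z) = spot k (σ p) z := by
  have h : spot k p z = (locate (allRight k)).symm (finCongr (numLeaves_allRight k).symm p, z) := by
    rw [locate_allRight_symm]; rfl
  rw [h]
  simp only [ofPerm, ofDiagram, Equiv.trans_apply, Equiv.apply_symm_apply, Equiv.prodCongr_apply,
    Prod.map_apply, Equiv.refl_apply]
  rw [locate_allRight_symm]
  simp

theorem exists_eq_spot (k : ℕ) (z : Square) : ∃ (p : Fin (k + 1)) (x : Square), z = spot k p x :=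
  ⟨⟨leafIndex (allRight k) z, by
    have := leafIndex_lt (allRight k) z; rwa [numLeaves_allRight] at this⟩,
    leafPos (allRight k) z, (spot_leafIndex_allRight k z).symm⟩

theorem ofPerm_one (k : ℕ) : ofPerm k 1 = Equiv.refl Square := by
  ext1 z
  obtain ⟨p, x, rfl⟩ := exists_eq_spot k z
  rw [ofPerm_spot]; rfl

theorem ofPerm_mul (k : ℕ) (σ τ : Equiv.Perm (Fin (k + 1))) :
    ofPerm k (σ * τ) = (ofPerm k τ).trans (ofPerm k σ) := by
  ext1 z
  obtain ⟨p, x, rfl⟩ := exists_eq_spot k z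
  rw [Equiv.trans_apply, ofPerm_spot, ofPerm_spot, ofPerm_spot]; rfl

/-- The last leaf of the defining tree is fixed, so it can be subdivided without changing the
element. -/
theorem P_val_eq_ofPerm (i k : ℕ) (h : i + 2 ≤ k) :
    (Letter.P i).val = ofPerm k (Equiv.swap ⟨i, by omega⟩ ⟨i + 1, by omega⟩) := by
  ext1 z
  obtain ⟨p, x, rfl⟩ := exists_eq_spot k z
  rw [ofPerm_spot, Letter.val]
  by_cases hp : (p : ℕ) < i + 2
  · have e := ofPerm_spot (i + 2) (Equiv.swap ⟨i, by omega⟩ ⟨i + 1, by omega⟩) ⟨p, by omega⟩ x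
    rw [spot_of_lt (by exact hp)] at e
    rw [spot_of_lt (by omega), e, Equiv.swap_apply_def, Equiv.swap_apply_def]
    simp only [Fin.ext_iff]
    split_ifs <;> simp only [spot] <;> split_ifs <;> first | rfl | omega
  · have hs : spot k p x = spot (i + 2) (i + 2) (spot (k - (i + 2)) (p - (i + 2)) x) := by
      rw [spot_self, rightEnd_spot]
      congr 1 <;> omega
    have e := ofPerm_spot (i + 2) (Equiv.swap ⟨i, by omega⟩ ⟨i + 1, by omega⟩)
      ⟨i + 2, by omega⟩ (spot (k - (i + 2)) (p - (i + 2)) x)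
    rw [Equiv.swap_apply_of_ne_of_ne (by simp [Fin.ext_iff]) (by simp [Fin.ext_iff])] at e
    rw [Equiv.swap_apply_of_ne_of_ne (by simp only [ne_eq, Fin.ext_iff]; omega)
      (by simp only [ne_eq, Fin.ext_iff]; omega), hs]
    exact e

theorem exists_permutationWord (k : ℕ) (σ : Equiv.Perm (Fin (k + 1))) :
    ∃ w, IsPermutationWord w ∧ eval w = ofPerm k σ := by
  -- Adjacent transpositions generate already as a monoid, so no inverse letters are needed.
  have hσ : σ ∈ Submonoid.closure (Set.range fun i : Fin k => Equiv.swap i.castSucc i.succ) := by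
    rw [Equiv.Perm.mclosure_swap_castSucc_succ]; trivial
  induction hσ using Submonoid.closure_induction with
  | mem τ hτ =>
    obtain ⟨⟨i, hi⟩, rfl⟩ := hτ
    -- Only the exchange of the last two leaves moves the end of the spine and requires `Pbar`.
    rcases Nat.eq_or_lt_of_le (Nat.succ_le_of_lt hi) with rfl | hi'
    · exact ⟨[.Pbar i], by simp [IsPermutationWord], rfl⟩
    · exact ⟨[.P i], by simp [IsPermutationWord], P_val_eq_ofPerm i k hi'⟩
  | one => exact ⟨[], by simp [IsPermutationWord], (ofPerm_one k).symm⟩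
  | mul σ τ _ _ hσ hτ =>
    obtain ⟨w, hw, h⟩ := hσ
    obtain ⟨w', hw', h'⟩ := hτ
    refine ⟨w' ++ w, fun x hx => ?_, by rw [eval_append, h, h', ofPerm_mul]⟩
    rcases List.mem_append.1 hx with hx | hx
    · exact hw' x hx
    · exact hw x hx

/-- A map that is affine on the leaves of `T`, with the leaves of `S` in some order as images, is
the product of the elements of `T`, of a permutation, and of the inverse of the element of `S`. -/
theorem exists_eq_ofTree_trans_ofPerm {f : Equiv.Perm Square} {T S : BinaryTree Caret}
    {L : List Rect} (h : List.Forall₂ (MapsRect f) (leafRects T) L) (hL : L.Perm (leafRects S)) :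
    ∃ σ : Equiv.Perm (Fin (S.numNodes + 1)),
      f = ((ofTree T).trans (ofPerm S.numNodes σ)).trans (ofTree S).symm := by
  have hTL : (leafRects T).length = L.length := h.length_eq
  have hLS : L.length = S.numNodes + 1 := by
    rw [hL.length_eq, length_leafRects, S.numLeaves_eq_numNodes_succ]
  have hTn : T.numNodes = S.numNodes := by
    rw [length_leafRects, T.numLeaves_eq_numNodes_succ] at hTL
    omega
  have hSl : (leafRects S).length = S.numNodes + 1 := hL.length_eq.symm.trans hLS
  -- The bijection of positions behind the permutation of lists; it becomes the leaf permutation σ.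
  let e : Fin L.length ≃ Fin (leafRects S).length :=
    ⟨hL.idxBij, hL.symm.idxBij, hL.idxBij_symm_leftInverse_idxBij,
      hL.idxBij_leftInverse_idxBij_symm⟩
  refine ⟨((finCongr hLS.symm).trans e).trans (finCongr hSl), ?_⟩
  ext1 z
  rw [Equiv.trans_apply, Equiv.trans_apply, Equiv.eq_symm_apply]
  obtain ⟨r, hr, hz⟩ := exists_leafRect_place T z
  have hp : leafIndex T z < L.length := by
    rw [← hTL, length_leafRects]; exact leafIndex_lt T z
  have hf : f z = Rect.place L[leafIndex T z] (leafPos T z) := by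
    have hm : MapsRect f ((leafRects T)[leafIndex T z]) L[leafIndex T z] := h.get (by omega) hp
    rw [(List.getElem_eq_iff _).2 hr] at hm
    conv_lhs => rw [hz]
    exact hm _
  have hS : f z = (locate S).symm
      (finCongr (length_leafRects S) (e ⟨leafIndex T z, hp⟩), leafPos T z) := by
    rw [hf, locate_symm_apply]
    congr 1
    exact (hL.getElem_idxBij_eq_getElem ⟨leafIndex T z, hp⟩).symm
  have hT := ofPerm_spot S.numNodes (((finCongr hLS.symm).trans e).trans (finCongr hSl))
    ⟨leafIndex T z, by omega⟩ (leafPos T z)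
  rw [ofTree_eq_spot T, hTn]
  refine Eq.trans ?_ hT.symm
  rw [hS, ofTree_eq_spot]
  simp [leafIndex, leafPos]

end Thompson2V

/-! ### Assembly of the theorem -/

open Thompson2V in
theorem mainTheorem4 (f : Equiv.Perm Square) (hf : f ∈ TwoV) :
    (∃! D : GridDiagram, D.IsReducedFor f) ∧
    (∃! w : List Letter, IsPrefixWord f w) ∧
    ∀ D : GridDiagram, D.IsReducedFor f →
      ∀ n m : ℕ, D.Tv.numLeaves = n + 1 → D.Th.numLeaves = m + 1 →
      ∃ a b b' : ℕ → ℕ,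
        -- the exponents are the leaf exponents
        a = spineExponent D.Tv ∧ b = spineExponent D.Th ∧ b' = interiorExponent D.Th ∧
        -- the word of the vertical tree, and its uniqueness
        eval (wordA n a) = ofTree (paint .vert D.Tv) ∧
        (∀ a₁ : ℕ → ℕ, eval (wordA n a₁) = ofTree (paint .vert D.Tv) → ∀ j ≤ n, a₁ j = a j) ∧
        -- the word of the horizontal tree on the spine, where the spine carets come from the `C`s
        eval (wordC 0 (spineCarets D.Th) ++ wordB 0 m b) = ofTree (paint .horiz D.Th) ∧
        (∀ b₁ : ℕ → ℕ, eval (wordC 0 (spineCarets D.Th) ++ wordB 0 m b₁) =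
          ofTree (paint .horiz D.Th) → ∀ p ≤ m, b₁ p = b p) ∧
        -- the word of the horizontal tree off the spine
        eval (wordB 0 m b') = ofTree (.node .vert (paint .horiz D.Th) .nil) ∧
        (∀ b₁ : ℕ → ℕ, eval (wordB 0 m b₁) = ofTree (.node .vert (paint .horiz D.Th) .nil) →
          ∀ p ≤ m, b₁ p = b' p) ∧
        (∀ p ≤ m, b' p = b p ∨ b' p = b p + 1) ∧
        -- the word of the full source tree is the prefix word of `f`, and its uniqueness
        IsPrefixWord f (gridWord n m (spineCarets D.Tv) (spineCarets D.Th) a b b') ∧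
        eval (gridWord n m (spineCarets D.Tv) (spineCarets D.Th) a b b') =
          ofTree (gridTree D.Tv D.Th) ∧
        (∀ w : List Letter, IsGridWord n m w → eval w = ofTree (gridTree D.Tv D.Th) →
          w = gridWord n m (spineCarets D.Tv) (spineCarets D.Th) a b b') ∧
        -- the normal form, for every tree of the target subdivision
        ∀ S : BinaryTree Caret, D.target.Perm (leafRects S) →
          ∃ (σ : Equiv.Perm (Fin (S.numNodes + 1))) (wP wN : List Letter),
            IsPermutationWord wP ∧ eval wP = ofPerm S.numNodes σ ∧
            IsStandardPositive wN ∧ eval wN = ofTree S ∧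
            f = ((eval (gridWord n m (spineCarets D.Tv) (spineCarets D.Th) a b b')).trans
              (eval wP)).trans (eval wN).symm := by
  have hgrid : ∀ Tv Th : BinaryTree Unit,
      eval (gridWord Tv.numNodes Th.numNodes (spineCarets Tv) (spineCarets Th)
        (spineExponent Tv) (spineExponent Th) (interiorExponent Th)) =
        ofTree (gridTree Tv Th) := fun Tv Th => by
    rw [← treeWord_gridTree, eval_treeWord]
  have hprefix : ∀ D : GridDiagram, D.IsReducedFor f → IsPrefixWord f
      (gridWord D.Tv.numNodes D.Th.numNodes (spineCarets D.Tv) (spineCarets D.Th)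
        (spineExponent D.Tv) (spineExponent D.Th) (interiorExponent D.Th)) := fun D hD =>
    ⟨D, hD, ⟨_, _, _, _, _, rfl⟩, hgrid _ _⟩
  have huniq : ∀ (Tv Th : BinaryTree Unit) (w : List Letter),
      IsGridWord Tv.numNodes Th.numNodes w → eval w = ofTree (gridTree Tv Th) →
      w = gridWord Tv.numNodes Th.numNodes (spineCarets Tv) (spineCarets Th)
        (spineExponent Tv) (spineExponent Th) (interiorExponent Th) := by
    rintro Tv Th _ ⟨i, s, a, b, b', rfl⟩ hw
    exact gridWord_injective (hw.trans (hgrid Tv Th).symm)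
  obtain ⟨D₀, hD₀⟩ := IsDyadic.exists_isReducedFor hf
  refine ⟨⟨D₀, hD₀, fun D hD => hD.unique hD₀⟩, ⟨_, hprefix D₀ hD₀, ?_⟩, ?_⟩
  · rintro w ⟨D, hD, hw, he⟩
    -- A prefix word may come with any reduced diagram; uniqueness of the diagram reduces the claim
    -- to one fixed source tree.
    obtain rfl := hD.unique hD₀
    exact huniq _ _ w hw he
  intro D hD n m hn hm
  obtain rfl : D.Tv.numNodes = n := by
    rw [D.Tv.numLeaves_eq_numNodes_succ] at hn; omega
  obtain rfl : D.Th.numNodes = m := by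
    rw [D.Th.numLeaves_eq_numNodes_succ] at hm; omega
  have hA : eval (wordA D.Tv.numNodes (spineExponent D.Tv)) = ofTree (paint .vert D.Tv) := by
    rw [← treeWord_paint_vert, eval_treeWord]
  have hB : eval (wordC 0 (spineCarets D.Th) ++ wordB 0 D.Th.numNodes (spineExponent D.Th)) =
      ofTree (paint .horiz D.Th) := by
    rw [← treeWord_paint_horiz, eval_treeWord]
  have hB' : eval (wordB 0 D.Th.numNodes (interiorExponent D.Th)) =
      ofTree (.node .vert (paint .horiz D.Th) .nil) := by
    rw [← treeWord_node_paint_horiz, eval_treeWord]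
  refine ⟨_, _, _, rfl, rfl, rfl, hA, fun a₁ h => wordA_injective (h.trans hA.symm), hB,
    fun b₁ h => wordB_injective (eval_append_left_cancel (h.trans hB.symm)), hB',
    fun b₁ h => wordB_injective (h.trans hB'.symm), fun p _ => interiorExponent_eq_or _ p,
    hprefix D hD, hgrid _ _, huniq _ _, fun S hS => ?_⟩
  obtain ⟨σ, hσ⟩ := exists_eq_ofTree_trans_ofPerm hD.1 hS
  obtain ⟨w, hw, he⟩ := exists_permutationWord S.numNodes σ
  refine ⟨σ, w, treeWord S, hw, he, isStandardPositive_treeWord S, eval_treeWord S, ?_⟩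
  rw [hgrid, he, eval_treeWord]
  exact hσ
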